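/- Let $(g,\nabla)$ be a smooth special Kähler structure on the punctured unit disc $B_1^*=\{z\in\mathbb C: 0<|z|<1\}$ with its standard complex structure $I$: $g$ is a Kähler metric with Kähler form $\omega=g(I\cdot,\cdot)$, and $\nabla$ is a flat, torsion-free connection on $TB_1^*$ with $\nabla\omega=0$ and $(\nabla_XI)Y=(\nabla_YI)X$. Let $\Xi=\Xi_0\,dz^3=-\omega(\pi^{1,0},\nabla\pi^{1,0})$ be its associated holomorphic cubic form, where $\pi^{1,0}$ is the projection of the complexified tangent bundle to its $(1,0)$-part, and assume that $\Xi_0$ is meromorphic at the origin, of order exactly $n\in\mathbb Z$ there. Let $\tilde g=\tau^*g_{\mathcal H}$ be the associated hyperbolic metric, where $g_{\mathcal H}=(\operatorname{Im}\tau)^{-2}|d\tau|^2$ is the metric of the upper half-plane and $\tau=\partial W/\partial Z$ is the (local) period map, $(Z,W)$ being local holomorphic functions with $\nabla\, d\operatorname{Re}Z=\nabla\, d\operatorname{Re}W=0$ and $\omega=-d\operatorname{Re}Z\wedge d\operatorname{Re}W$; $\tilde g$ does not depend on the choice of $(Z,W)$. Write $r=|z|$; all $o(1)$ are for $z\to0$.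 A metric $f\,|dz|^2$ is called conical of order $\alpha\in\mathbb R$ (at the origin) if $f=r^{2\alpha}(C+o(1))$ for some constant $C>0$; it has a logarithmic singularity of order $k/2$, $k\in\mathbb Z$, if $f=-r^{k}\log r\,(C+o(1))$ for some constant $C>0$; it has a cusp if $f=(C+o(1))/(r\log r)^{2}$ for some constant $C>0$. Then: 1. For every $\beta\in\mathbb R$, $g$ is conical of order $\beta/2$, that is $g=r^{\beta}(C+o(1))|dz|^2$ for some $C>0$, if and only if $\tilde g$ is conical of order $n-\beta$, that is $\tilde g=r^{2(n-\beta)}(C'+o(1))|dz|^2$ for some $C'>0$; and in this case $n-\beta>-1$. 2. $g$ has a logarithmic singularity (of some order $k/2$, $k\in\mathbb Z$) if and only if $\tilde g$ has a cusp; moreover this holds if and only if $g$ has a logarithmic singularity of order $(n+1)/2$, that is, $g=-r^{n+1}\log r\,(C+o(1))|dz|^2$ for some $C>0$ if and only if $\tilde g=\dfrac{C'+o(1)}{(r\log r)^2}|dz|^2$ for some $C'>0$. -/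

import Mathlib

open Filter Topology
open scoped ContDiff

/-- The punctured unit disc `{0 < |z| < 1}`. -/
def puncturedDisc : Set ℂ := {z | 0 < ‖z‖ ∧ ‖z‖ < 1}

/-- The standard Kähler form on `ℂ`, `(X, Y) ↦ ⟨iX, Y⟩`, that is `dx ∧ dy`. -/
noncomputable def stdKahlerForm (X Y : ℂ) : ℝ := inner ℝ (Complex.I * X) Y

/-- A (smooth) special Kähler structure `(g, ∇)` on the punctured unit disc with its standard
complex structure `I` (multiplication by `i`).  All tensors are written in the global coordinate
`z`, and the tangent space at each point is `ℂ`, viewed as a real plane.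
In complex dimension one the Kähler metrics are exactly the metrics `g = dens · |dz|²` with
`dens > 0`; the Kähler form is then `ω(X, Y) = g(I X, Y) = dens · dx ∧ dy` (closed for reasons of
degree). The connection is `∇_X Y = D_X Y + conn(X) Y` with a smooth `conn`, real bilinear in
`(X, Y)`. -/
structure SpecialKahlerStructure where
  /-- the density `e^{-u}` of the metric `g = e^{-u} |dz|²` -/
  dens : ℂ → ℝ
  /-- the connection form of `∇` in the trivialization by the coordinate fields -/
  conn : ℂ → ℂ →ₗ[ℝ] ℂ →ₗ[ℝ] ℂ
  dens_smooth : ContDiffOn ℝ ∞ dens puncturedDisc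
  dens_pos : ∀ z ∈ puncturedDisc, 0 < dens z
  conn_smooth : ∀ X Y : ℂ, ContDiffOn ℝ ∞ (fun z => conn z X Y) puncturedDisc
  /-- `∇` is flat: `R(X, Y) V = ∇_X ∇_Y V - ∇_Y ∇_X V = 0` for constant `X`, `Y`, `V` -/
  flat : ∀ z ∈ puncturedDisc, ∀ X Y V : ℂ,
    fderiv ℝ (fun w => conn w Y V) z X - fderiv ℝ (fun w => conn w X V) z Y
      + conn z X (conn z Y V) - conn z Y (conn z X V) = 0
  /-- `∇` is torsion-free -/
  torsion_free : ∀ z ∈ puncturedDisc, ∀ X Y : ℂ, conn z X Y = conn z Y X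
  /-- `∇` is symplectic: `X (ω(Y, V)) = ω(∇_X Y, V) + ω(Y, ∇_X V)` for constant `Y`, `V` -/
  symplectic : ∀ z ∈ puncturedDisc, ∀ X Y V : ℂ,
    fderiv ℝ (fun w => dens w * stdKahlerForm Y V) z X
      = dens z * stdKahlerForm (conn z X Y) V + dens z * stdKahlerForm Y (conn z X V)
  /-- `(∇_X I) Y = (∇_Y I) X` -/
  special : ∀ z ∈ puncturedDisc, ∀ X Y : ℂ,
    conn z X (Complex.I * Y) - Complex.I * conn z X Y
      = conn z Y (Complex.I * X) - Complex.I * conn z Y X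

namespace SpecialKahlerStructure

variable (S : SpecialKahlerStructure)

/-- The Kähler form `ω` at `z`. -/
noncomputable def kahlerForm (z X Y : ℂ) : ℝ := S.dens z * stdKahlerForm X Y

/-- `(∇_X I) Y = ∇_X (I Y) - I ∇_X Y` at `z`. -/
noncomputable def nablaI (z X Y : ℂ) : ℂ :=
  S.conn z X (Complex.I * Y) - Complex.I * S.conn z X Y

/-- The complex bilinear extension of `ω` to the complexified tangent space, in which a pair
`(a, b)` stands for `a + √-1 b` with real tangent vectors `a`, `b`. -/
noncomputable def kahlerFormC (z : ℂ) (X Y : ℂ × ℂ) : ℂ :=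
  ((S.kahlerForm z X.1 Y.1 - S.kahlerForm z X.2 Y.2 : ℝ) : ℂ)
    + ((S.kahlerForm z X.1 Y.2 + S.kahlerForm z X.2 Y.1 : ℝ) : ℂ) * Complex.I

/-- The projection `π^{1,0} X = (X - √-1 I X) / 2` of a real tangent vector to its `(1,0)`-part,
as an element of the complexified tangent space. -/
noncomputable def proj10 (X : ℂ) : ℂ × ℂ := (X / 2, -(Complex.I * X) / 2)

/-- `(∇_Y π^{1,0}) V = -√-1 (∇_Y I) V / 2`. -/
noncomputable def nablaProj10 (z Y V : ℂ) : ℂ × ℂ := (0, -(S.nablaI z Y V) / 2)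

/-- The associated cubic form `Ξ = -ω(π^{1,0}, ∇π^{1,0})`, as a trilinear form. -/
noncomputable def cubicForm (z X Y V : ℂ) : ℂ :=
  -S.kahlerFormC z (proj10 X) (S.nablaProj10 z Y V)

/-- The coefficient `Ξ₀` in `Ξ = Ξ₀ dz³`, i.e. the value of `Ξ` on `(∂_x, ∂_x, ∂_x)`
(note `dz(∂_x) = 1`). -/
noncomputable def cubicCoeff (z : ℂ) : ℂ := S.cubicForm z 1 1 1

/-- `∇ df = 0` on `U`: `X (df(Y)) = df(∇_X Y)` for constant `X`, `Y`. -/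
def IsFlatFunction (U : Set ℂ) (f : ℂ → ℝ) : Prop :=
  ∀ z ∈ U, ∀ X Y : ℂ,
    fderiv ℝ (fun w => fderiv ℝ f w Y) z X = fderiv ℝ f z (S.conn z X Y)

/-- `(Z, W)` is a pair of conjugate special holomorphic coordinates on `U`: `Z`, `W` are
holomorphic, `Re Z` and `Re W` are flat, and `(Re Z, -Re W)` are Darboux coordinates, i.e.
`ω = -dRe Z ∧ dRe W`. The last condition forces `Z' ≠ 0` and `W' ≠ 0` on `U`. -/
structure IsConjugateSpecialPair (U : Set ℂ) (Z W : ℂ → ℂ) : Prop where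
  isOpen : IsOpen U
  subset : U ⊆ puncturedDisc
  holo_Z : DifferentiableOn ℂ Z U
  holo_W : DifferentiableOn ℂ W U
  flat_Z : S.IsFlatFunction U (fun w => (Z w).re)
  flat_W : S.IsFlatFunction U (fun w => (W w).re)
  darboux : ∀ z ∈ U, ∀ X Y : ℂ,
    S.kahlerForm z X Y =
      -(fderiv ℝ (fun w => (Z w).re) z X * fderiv ℝ (fun w => (W w).re) z Y
        - fderiv ℝ (fun w => (Z w).re) z Y * fderiv ℝ (fun w => (W w).re) z X)

/-- The period map `τ = ∂W/∂Z` of a pair of conjugate special holomorphic coordinates. -/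
noncomputable def periodMap (Z W : ℂ → ℂ) (z : ℂ) : ℂ := deriv W z / deriv Z z

/-- The density at `z` of the pull-back `τ^*((Im τ)⁻² |dτ|²)` of the hyperbolic metric of the
upper half-plane by the holomorphic map `τ`. -/
noncomputable def hyperbolicPullback (τ : ℂ → ℂ) (z : ℂ) : ℝ :=
  ‖deriv τ z‖ ^ 2 / (τ z).im ^ 2

/-- The density of the associated hyperbolic metric `g̃ = τ^* g_H`: its value at `z` is computed
from any period map defined near `z` (the value does not depend on the chosen one). -/
noncomputable def hypDens (z : ℂ) : ℝ :=
  Classical.epsilon fun c : ℝ => ∃ (U : Set ℂ) (Z W : ℂ → ℂ),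
    z ∈ U ∧ S.IsConjugateSpecialPair U Z W ∧ c = hyperbolicPullback (periodMap Z W) z

end SpecialKahlerStructure

/-- The metric `f |dz|²` is conical of order `α` at the origin:
`f = r^{2α} (C + o(1))` as `r = |z| → 0`, for some constant `C > 0`. -/
def IsConicalOfOrder (f : ℂ → ℝ) (α : ℝ) : Prop :=
  ∃ C : ℝ, 0 < C ∧ Tendsto (fun z => f z / ‖z‖ ^ (2 * α)) (𝓝[≠] 0) (𝓝 C)

/-- The metric `f |dz|²` has a logarithmic singularity of order `k/2` at the origin:
`f = -r^k log r (C + o(1))` as `r = |z| → 0`, for some constant `C > 0`. -/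
def HasLogSingularity (f : ℂ → ℝ) (k : ℤ) : Prop :=
  ∃ C : ℝ, 0 < C ∧
    Tendsto (fun z => f z / (-(‖z‖ ^ k * Real.log ‖z‖))) (𝓝[≠] 0) (𝓝 C)

/-- The metric `f |dz|²` has a cusp at the origin:
`f = (C + o(1)) / (r log r)²` as `r = |z| → 0`, for some constant `C > 0`. -/
def HasCusp (f : ℂ → ℝ) : Prop :=
  ∃ C : ℝ, 0 < C ∧ Tendsto (fun z => f z * (‖z‖ * Real.log ‖z‖) ^ 2) (𝓝[≠] 0) (𝓝 C)

/-!
In the holomorphic frame the connection has the form `∇_X Y = D_X Y + a X Y + conj (b X Y)`.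
Parallelism of `ω` says that `a` is the logarithmic `z`-derivative of `dens`, flatness then yields
`Δ log dens = -4 |b|²`, and `Ξ₀` is a constant multiple of `dens · b`. In special coordinates
`g̃ = 16 |Ξ₀|² / dens² |dz|²`, so that `g` and `g̃` determine each other's leading terms and
`-log dens` satisfies the Liouville equation `Δ(-log dens) = g̃`.

The orders are restricted by the maximum principle applied to `v = β log |z| - log dens` on a
punctured disc. Adding `t log |z|` to a strictly subharmonic function and letting `t → -∞`, or
`t → 0`, shows that `Δ v ≥ c / |z|²` is incompatible with `v` being bounded above, and that if `Δ v`
is bounded above and `v = o(log |z|)` then `v` is bounded below. A conical order with `n - β ≤ -1`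
would violate the first principle; a logarithmic singularity of order `k / 2` violates the first one
if `k > n + 1` and the second one if `k < n + 1`.
-/

open scoped ComplexConjugate Laplacian

theorem realLinear_apply (L : ℂ →ₗ[ℝ] ℂ) (X : ℂ) :
    L X = (L 1 - Complex.I * L Complex.I) / 2 * X
      + (L 1 + Complex.I * L Complex.I) / 2 * conj X := by
  have hX : L X = X.re * L 1 + X.im * L Complex.I := by
    conv_lhs => rw [show X = X.re • (1 : ℂ) + X.im • Complex.I by simp [Complex.re_add_im]]
    rw [map_add, map_smul, map_smul, Complex.real_smul, Complex.real_smul]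
  rw [hX, Complex.re_eq_add_conj, Complex.im_eq_sub_conj]
  field_simp
  linear_combination (L Complex.I * (X - conj X)) * Complex.I_sq

/-- The real-linear map `X ↦ α X + β X̄`; every real-linear endomorphism of `ℂ` has this form. -/
noncomputable def wirtinger (α β : ℂ) : ℂ →L[ℝ] ℂ :=
  α • ContinuousLinearMap.id ℝ ℂ + β • (Complex.conjCLE : ℂ →L[ℝ] ℂ)

@[simp]
theorem wirtinger_apply (α β X : ℂ) : wirtinger α β X = α * X + β * conj X := by
  simp [wirtinger]

theorem norm_wirtinger_le (α β : ℂ) : ‖wirtinger α β‖ ≤ ‖α‖ + ‖β‖ :=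
  ContinuousLinearMap.opNorm_le_bound _ (by positivity) fun X => by
    rw [wirtinger_apply, add_mul]
    exact (norm_add_le _ _).trans_eq (by simp)

/-- The Wirtinger derivative `∂f/∂z = (∂f/∂x - i ∂f/∂y) / 2`. -/
noncomputable def wirtingerDeriv (f : ℂ → ℂ) (z : ℂ) : ℂ :=
  (fderiv ℝ f z 1 - Complex.I * fderiv ℝ f z Complex.I) / 2

/-- The conjugate Wirtinger derivative `∂f/∂z̄ = (∂f/∂x + i ∂f/∂y) / 2`. -/
noncomputable def wirtingerDerivConj (f : ℂ → ℂ) (z : ℂ) : ℂ :=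
  (fderiv ℝ f z 1 + Complex.I * fderiv ℝ f z Complex.I) / 2

/-- `f` is real differentiable at `z`, with `∂f/∂z = α` and `∂f/∂z̄ = β`. -/
def HasWirtingerDerivAt (f : ℂ → ℂ) (α β z : ℂ) : Prop := HasFDerivAt f (wirtinger α β) z

theorem contDiffOn_wirtingerDeriv {f : ℂ → ℂ} {U : Set ℂ} (hf : ContDiffOn ℝ ∞ f U)
    (hU : IsOpen U) : ContDiffOn ℝ ∞ (wirtingerDeriv f) U := by
  have h (X : ℂ) : ContDiffOn ℝ ∞ (fun z => fderiv ℝ f z X) U :=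
    (hf.fderiv_of_isOpen hU (by simp)).clm_apply contDiffOn_const
  exact ((h 1).sub (contDiffOn_const.mul (h Complex.I))).div_const 2

namespace HasWirtingerDerivAt

variable {f g : ℂ → ℂ} {α β α' β' z : ℂ}

theorem of_hasFDerivAt {L : ℂ →L[ℝ] ℂ} (h : HasFDerivAt f L z)
    (hL : ∀ X, L X = α * X + β * conj X) : HasWirtingerDerivAt f α β z := by
  have : L = wirtinger α β := by ext1 X; rw [hL, wirtinger_apply]
  rwa [HasWirtingerDerivAt, ← this]

theorem of_differentiableAt (h : DifferentiableAt ℝ f z) :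
    HasWirtingerDerivAt f (wirtingerDeriv f z) (wirtingerDerivConj f z) z :=
  of_hasFDerivAt h.hasFDerivAt (realLinear_apply (fderiv ℝ f z).toLinearMap)

theorem of_hasDerivAt (h : HasDerivAt f α z) : HasWirtingerDerivAt f α 0 z :=
  of_hasFDerivAt (h.hasFDerivAt.restrictScalars ℝ) fun X => by simp [mul_comm]

theorem hasDerivAt (h : HasWirtingerDerivAt f α 0 z) : HasDerivAt f α z := by
  rw [hasDerivAt_iff_hasFDerivAt]
  exact hasFDerivAt_of_restrictScalars ℝ h (by ext X; simp [mul_comm])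

theorem congr_deriv (hf : HasWirtingerDerivAt f α β z) (hα : α = α') (hβ : β = β') :
    HasWirtingerDerivAt f α' β' z :=
  hα ▸ hβ ▸ hf

theorem congr_of_eventuallyEq (hf : HasWirtingerDerivAt f α β z) (h : g =ᶠ[𝓝 z] f) :
    HasWirtingerDerivAt g α β z :=
  HasFDerivAt.congr_of_eventuallyEq hf h

theorem const_mul (c : ℂ) (hf : HasWirtingerDerivAt f α β z) :
    HasWirtingerDerivAt (fun w => c * f w) (c * α) (c * β) z :=
  of_hasFDerivAt (HasFDerivAt.const_mul hf c) fun X => by simp; ring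

theorem add (hf : HasWirtingerDerivAt f α β z) (hg : HasWirtingerDerivAt g α' β' z) :
    HasWirtingerDerivAt (fun w => f w + g w) (α + α') (β + β') z :=
  of_hasFDerivAt (HasFDerivAt.add hf hg) fun X => by simp; ring

theorem sub (hf : HasWirtingerDerivAt f α β z) (hg : HasWirtingerDerivAt g α' β' z) :
    HasWirtingerDerivAt (fun w => f w - g w) (α - α') (β - β') z :=
  of_hasFDerivAt (HasFDerivAt.sub hf hg) fun X => by simp; ring

theorem mul (hf : HasWirtingerDerivAt f α β z) (hg : HasWirtingerDerivAt g α' β' z) :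
    HasWirtingerDerivAt (fun w => f w * g w) (α * g z + f z * α') (β * g z + f z * β') z :=
  of_hasFDerivAt (HasFDerivAt.mul hf hg) fun X => by simp; ring

theorem star (hf : HasWirtingerDerivAt f α β z) :
    HasWirtingerDerivAt (fun w => conj (f w)) (conj β) (conj α) z :=
  of_hasFDerivAt ((Complex.conjCLE : ℂ →L[ℝ] ℂ).hasFDerivAt.comp z hf) fun X => by simp; ring

theorem log {u : ℂ → ℝ} (hu : HasWirtingerDerivAt (fun w => (u w : ℂ)) α β z) (h0 : u z ≠ 0) :
    HasWirtingerDerivAt (fun w => (Real.log (u w) : ℂ)) (α / u z) (β / u z) z := by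
  have hre : HasFDerivAt u (Complex.reCLM.comp (wirtinger α β)) z :=
    Complex.reCLM.hasFDerivAt.comp z hu
  have hofReal : Complex.ofRealCLM.comp (Complex.reCLM.comp (wirtinger α β)) = wirtinger α β :=
    (Complex.ofRealCLM.hasFDerivAt.comp z hre).unique hu
  refine of_hasFDerivAt (Complex.ofRealCLM.hasFDerivAt.comp z (hre.log h0)) fun X => ?_
  have hX : ((wirtinger α β X).re : ℂ) = wirtinger α β X :=
    DFunLike.congr_fun hofReal X
  calc (((u z)⁻¹ * (wirtinger α β X).re : ℝ) : ℂ) = (u z : ℂ)⁻¹ * wirtinger α β X := by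
        rw [Complex.ofReal_mul, hX, Complex.ofReal_inv]
    _ = α / u z * X + β / u z * conj X := by rw [wirtinger_apply]; ring

theorem mixed_deriv_eq {A B : ℂ → ℂ} (hf : ∀ᶠ w in 𝓝 z, HasWirtingerDerivAt f (A w) (B w) w)
    (hA : HasWirtingerDerivAt A α β z) (hB : HasWirtingerDerivAt B α' β' z) : β = α' := by
  have hA' := HasFDerivAt.smul_const hA (ContinuousLinearMap.id ℝ ℂ)
  have hB' := HasFDerivAt.smul_const hB (Complex.conjCLE : ℂ →L[ℝ] ℂ)
  have := second_derivative_symmetric_of_eventually hf (hA'.add hB') 1 Complex.I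
  simp only [add_apply, smul_apply, ContinuousLinearMap.smulRight_apply, wirtinger_apply, mul_one,
    map_one, ContinuousLinearMap.id_apply, smul_eq_mul, ContinuousLinearEquiv.coe_coe,
    ContinuousAlgEquiv.coeCLE_apply, Complex.conjCAE_apply, Complex.conj_I, mul_neg] at this
  linear_combination -Complex.I * this / 2 + (β - α') * Complex.I_sq

theorem laplacian_eq {u : ℂ → ℝ} {A : ℂ → ℂ}
    (hu : ∀ᶠ w in 𝓝 z, HasWirtingerDerivAt (fun w => (u w : ℂ)) (A w) (conj (A w)) w)
    (hA : HasWirtingerDerivAt A α β z) : Δ u z = 4 * β.re := by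
  let T : ℂ →L[ℝ] ℂ →L[ℝ] ℝ :=
    (ContinuousLinearMap.compL ℝ ℂ ℂ ℝ (2 • Complex.reCLM)).comp (ContinuousLinearMap.mul ℝ ℂ)
  have hT (c X : ℂ) : T c X = 2 * (c * X).re := by simp [T]
  have hfst : fderiv ℝ u =ᶠ[𝓝 z] fun w => T (A w) := by
    filter_upwards [hu] with w hw
    have : HasFDerivAt u (Complex.reCLM.comp (wirtinger (A w) (conj (A w)))) w :=
      Complex.reCLM.hasFDerivAt.comp w hw
    ext1 X
    rw [this.fderiv, hT]
    simp only [ContinuousLinearMap.comp_apply, wirtinger_apply, Complex.reCLM_apply,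
      Complex.add_re, Complex.mul_re, Complex.conj_re, Complex.conj_im]
    ring
  have hsnd : HasFDerivAt (fderiv ℝ u) (T.comp (wirtinger α β)) z :=
    (T.hasFDerivAt.comp z hA).congr_of_eventuallyEq hfst
  simp only [InnerProductSpace.laplacian_eq_iteratedFDeriv_complexPlane, iteratedFDeriv_two_apply,
    hsnd.fderiv, ContinuousLinearMap.comp_apply, hT, wirtinger_apply]
  simp only [Fin.isValue, Matrix.cons_val_zero, mul_one, map_one, Matrix.cons_val_one,
    Matrix.cons_val_fin_one, Complex.add_re, Complex.conj_I, mul_neg, Complex.mul_re, Complex.I_re,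
    mul_zero, Complex.I_im, zero_sub, Complex.neg_re, neg_neg, Complex.add_im, Complex.mul_im,
    add_zero, Complex.neg_im]
  ring

end HasWirtingerDerivAt

theorem eq_zero_of_starConvex_of_norm_fderiv_le {E F : Type*} [NormedAddCommGroup E]
    [NormedSpace ℝ E] [NormedAddCommGroup F] [NormedSpace ℝ F] {s : Set E} {x₀ x : E} {f : E → F}
    {f' : E → E →L[ℝ] F} {k : E → ℝ} (hs : StarConvex ℝ x₀ s)
    (hf : ∀ y ∈ s, HasFDerivAt f (f' y) y) (hk : ContinuousOn k s)
    (hf' : ∀ y ∈ s, ‖f' y‖ ≤ k y * ‖f y‖) (h0 : f x₀ = 0) (hx : x ∈ s) : f x = 0 := by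
  let γ := fun t : ℝ => x₀ + t • (x - x₀)
  have hγs : ∀ t ∈ Set.Icc (0 : ℝ) 1, γ t ∈ s := fun t ht => hs.add_smul_sub_mem hx ht.1 ht.2
  have hγ (t : ℝ) : HasDerivAt γ (x - x₀) t := by
    simpa [γ] using ((hasDerivAt_id t).smul_const (x - x₀)).const_add x₀
  have hfγ : ∀ t ∈ Set.Icc (0 : ℝ) 1, HasDerivAt (f ∘ γ) (f' (γ t) (x - x₀)) t := fun t ht =>
    (hf _ (hγs t ht)).comp_hasDerivAt t (hγ t)
  obtain ⟨K, hK⟩ := isCompact_Icc.bddAbove_image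
    (hk.comp (fun t _ => (hγ t).continuousAt.continuousWithinAt) hγs)
  have hbound : ∀ t ∈ Set.Ico (0 : ℝ) 1,
      ‖f' (γ t) (x - x₀)‖ ≤ K * ‖x - x₀‖ * ‖(f ∘ γ) t‖ := fun t ht => by
    have ht' := Set.Ico_subset_Icc_self ht
    calc ‖f' (γ t) (x - x₀)‖ ≤ ‖f' (γ t)‖ * ‖x - x₀‖ := (f' (γ t)).le_opNorm _
      _ ≤ k (γ t) * ‖f (γ t)‖ * ‖x - x₀‖ := by gcongr; exact hf' _ (hγs t ht')
      _ ≤ K * ‖f (γ t)‖ * ‖x - x₀‖ := by gcongr; exact hK (Set.mem_image_of_mem _ ht')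
      _ = _ := by simp only [Function.comp_apply]; ring
  have := eq_zero_of_abs_deriv_le_mul_abs_self_of_eq_zero_right
    (fun t ht => (hfγ t ht).continuousAt.continuousWithinAt)
    (fun t ht => (hfγ t (Set.Ico_subset_Icc_self ht)).hasDerivWithinAt)
    (by simpa [γ] using h0) hbound 1 (by simp)
  simpa [γ] using this

theorem eq_zero_of_hasWirtingerDerivAt {s : Set ℂ} {x₀ z : ℂ} {f α β : ℂ → ℂ} {k : ℂ → ℝ}
    (hs : StarConvex ℝ x₀ s) (hf : ∀ w ∈ s, HasWirtingerDerivAt f (α w) (β w) w)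
    (hk : ContinuousOn k s) (hαβ : ∀ w ∈ s, ‖α w‖ + ‖β w‖ ≤ k w * ‖f w‖) (h0 : f x₀ = 0)
    (hz : z ∈ s) : f z = 0 :=
  eq_zero_of_starConvex_of_norm_fderiv_le hs hf hk
    (fun w hw => (norm_wirtinger_le _ _).trans (hαβ w hw)) h0 hz

theorem isOpen_puncturedDisc : IsOpen puncturedDisc :=
  (isOpen_lt continuous_const continuous_norm).inter (isOpen_lt continuous_norm continuous_const)

theorem stdKahlerForm_eq (X Y : ℂ) : stdKahlerForm X Y = (conj X * Y).im := by
  simp [stdKahlerForm, Complex.inner]; ring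

namespace SpecialKahlerStructure

/-- The coefficient `a` in `∇_X Y = D_X Y + a X Y + conj (b X Y)`. -/
noncomputable def connHol (S : SpecialKahlerStructure) (z : ℂ) : ℂ :=
  (S.conn z 1 1 - Complex.I * S.conn z 1 Complex.I) / 2

/-- The coefficient `b` in `∇_X Y = D_X Y + a X Y + conj (b X Y)`. -/
noncomputable def connAnti (S : SpecialKahlerStructure) (z : ℂ) : ℂ :=
  conj ((S.conn z 1 1 + Complex.I * S.conn z 1 Complex.I) / 2)

variable {S : SpecialKahlerStructure} {z : ℂ}

theorem conn_eq (hz : z ∈ puncturedDisc) (X Y : ℂ) :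
    S.conn z X Y = X * Y * S.connHol z + conj (X * Y * S.connAnti z) := by
  have hI1 : S.conn z Complex.I 1 = S.conn z 1 Complex.I := S.torsion_free z hz _ _
  have hII : S.conn z Complex.I Complex.I = -S.conn z 1 1 := by
    have h := S.special z hz 1 Complex.I
    rw [hI1, mul_one, Complex.I_mul_I, map_neg, sub_left_inj] at h
    exact h.symm
  have hX := realLinear_apply ((S.conn z).flip Y) X
  simp only [LinearMap.flip_apply] at hX
  rw [hX, realLinear_apply (S.conn z 1) Y, realLinear_apply (S.conn z Complex.I) Y, hI1, hII,
    connHol, connAnti, map_mul, map_mul, Complex.conj_conj]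
  linear_combination (-S.conn z 1 1 * (X - conj X) * (Y - conj Y) / 4) * Complex.I_sq

theorem contDiffOn_connHol : ContDiffOn ℝ ∞ S.connHol puncturedDisc :=
  ((S.conn_smooth 1 1).sub (contDiffOn_const.mul (S.conn_smooth 1 Complex.I))).div_const 2

theorem contDiffOn_connAnti : ContDiffOn ℝ ∞ S.connAnti puncturedDisc :=
  Complex.conjCLE.contDiff.comp_contDiffOn
    (((S.conn_smooth 1 1).add (contDiffOn_const.mul (S.conn_smooth 1 Complex.I))).div_const 2)

theorem hasWirtingerDerivAt_dens (hz : z ∈ puncturedDisc) :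
    HasWirtingerDerivAt (fun w => (S.dens w : ℂ)) (S.dens z * S.connHol z)
      (S.dens z * conj (S.connHol z)) z := by
  have hd : DifferentiableAt ℝ S.dens z :=
    (S.dens_smooth.contDiffAt (isOpen_puncturedDisc.mem_nhds hz)).differentiableAt (by simp)
  refine .of_hasFDerivAt (Complex.ofRealCLM.hasFDerivAt.comp z hd.hasFDerivAt) fun X => ?_
  have h := S.symplectic z hz X 1 Complex.I
  simp only [stdKahlerForm_eq, conn_eq hz, map_one, one_mul, Complex.I_im, mul_one] at h
  simp only [ContinuousLinearMap.comp_apply, h, Complex.ofRealCLM_apply]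
  apply Complex.ext <;> simp <;> ring

theorem hasWirtingerDerivAt_log_dens (hz : z ∈ puncturedDisc) :
    HasWirtingerDerivAt (fun w => (Real.log (S.dens w) : ℂ)) (S.connHol z) (conj (S.connHol z))
      z := by
  have h0 := (S.dens_pos z hz).ne'
  have h0' : (S.dens z : ℂ) ≠ 0 := Complex.ofReal_ne_zero.2 h0
  exact ((hasWirtingerDerivAt_dens hz).log h0).congr_deriv (mul_div_cancel_left₀ _ h0')
    (mul_div_cancel_left₀ _ h0')

theorem differentiableAt_connHol (hz : z ∈ puncturedDisc) : DifferentiableAt ℝ S.connHol z :=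
  (contDiffOn_connHol.contDiffAt (isOpen_puncturedDisc.mem_nhds hz)).differentiableAt (by simp)

theorem differentiableAt_connAnti (hz : z ∈ puncturedDisc) : DifferentiableAt ℝ S.connAnti z :=
  (contDiffOn_connAnti.contDiffAt (isOpen_puncturedDisc.mem_nhds hz)).differentiableAt (by simp)

theorem hasWirtingerDerivAt_conn (hz : z ∈ puncturedDisc) (Y V : ℂ) :
    HasWirtingerDerivAt (fun w => S.conn w Y V)
      (Y * V * wirtingerDeriv S.connHol z + conj (Y * V * wirtingerDerivConj S.connAnti z))
      (Y * V * wirtingerDerivConj S.connHol z + conj (Y * V * wirtingerDeriv S.connAnti z)) z := by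
  have ha := HasWirtingerDerivAt.of_differentiableAt (differentiableAt_connHol (S := S) hz)
  have hb := HasWirtingerDerivAt.of_differentiableAt (differentiableAt_connAnti (S := S) hz)
  refine (ha.const_mul (Y * V)).add (hb.const_mul (Y * V)).star |>.congr_of_eventuallyEq ?_
  filter_upwards [isOpen_puncturedDisc.mem_nhds hz] with w hw using conn_eq hw Y V

theorem wirtingerDerivConj_conn_eq (hz : z ∈ puncturedDisc) :
    wirtingerDerivConj S.connHol z = -(S.connAnti z * conj (S.connAnti z)) ∧
      wirtingerDerivConj S.connAnti z = -(conj (S.connHol z) * S.connAnti z) := by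
  set A := wirtingerDerivConj S.connHol z + S.connAnti z * conj (S.connAnti z)
  set B := wirtingerDerivConj S.connAnti z + conj (S.connHol z) * S.connAnti z
  have hflat (V : ℂ) : V * A = conj (V * B) := by
    have hconn (Y V : ℂ) := HasFDerivAt.fderiv (hasWirtingerDerivAt_conn (S := S) hz Y V)
    have h := S.flat z hz 1 Complex.I V
    simp only [hconn, wirtinger_apply, conn_eq hz, map_add, map_mul, map_neg, map_one,
      Complex.conj_I, Complex.conj_conj] at h
    simp only [A, B, map_mul, map_add, Complex.conj_conj]
    refine mul_left_cancel₀ (mul_ne_zero two_ne_zero Complex.I_ne_zero) ?_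
    linear_combination h
  have h1 : A = conj B := by simpa only [one_mul] using hflat 1
  have hI : Complex.I * A = conj (Complex.I * B) := hflat Complex.I
  rw [map_mul, Complex.conj_I, ← h1, neg_mul, self_eq_neg, mul_eq_zero,
    or_iff_right Complex.I_ne_zero] at hI
  have hB : B = 0 := by simpa [hI] using h1.symm
  exact ⟨eq_neg_of_add_eq_zero_left hI, eq_neg_of_add_eq_zero_left hB⟩

theorem hasWirtingerDerivAt_connHol (hz : z ∈ puncturedDisc) :
    HasWirtingerDerivAt S.connHol (wirtingerDeriv S.connHol z)
      (-(S.connAnti z * conj (S.connAnti z))) z :=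
  (wirtingerDerivConj_conn_eq hz).1 ▸ .of_differentiableAt (differentiableAt_connHol hz)

theorem hasWirtingerDerivAt_connAnti (hz : z ∈ puncturedDisc) :
    HasWirtingerDerivAt S.connAnti (wirtingerDeriv S.connAnti z)
      (-(conj (S.connHol z) * S.connAnti z)) z :=
  (wirtingerDerivConj_conn_eq hz).2 ▸ .of_differentiableAt (differentiableAt_connAnti hz)

theorem laplacian_log_dens (hz : z ∈ puncturedDisc) :
    Δ (fun w => Real.log (S.dens w)) z = -4 * ‖S.connAnti z‖ ^ 2 := by
  have hlog : ∀ᶠ w in 𝓝 z, HasWirtingerDerivAt (fun w => (Real.log (S.dens w) : ℂ))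
      (S.connHol w) (conj (S.connHol w)) w := by
    filter_upwards [isOpen_puncturedDisc.mem_nhds hz] with w hw
      using hasWirtingerDerivAt_log_dens hw
  rw [HasWirtingerDerivAt.laplacian_eq hlog (hasWirtingerDerivAt_connHol hz),
    Complex.mul_conj, Complex.normSq_eq_norm_sq, Complex.neg_re, Complex.ofReal_re]
  ring

theorem cubicCoeff_eq (hz : z ∈ puncturedDisc) :
    S.cubicCoeff z = -(Complex.I / 2) * (S.dens z * S.connAnti z) := by
  simp only [cubicCoeff, cubicForm, kahlerFormC, proj10, nablaProj10, nablaI, kahlerForm,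
    stdKahlerForm_eq, conn_eq hz]
  have h2 : conj (2 : ℂ) = 2 := Complex.conj_ofNat 2
  apply Complex.ext <;> simp [h2, Complex.normSq] <;> ring

theorem norm_cubicCoeff (hz : z ∈ puncturedDisc) :
    ‖S.cubicCoeff z‖ = S.dens z * ‖S.connAnti z‖ / 2 := by
  simp only [cubicCoeff_eq hz, norm_mul, norm_neg, norm_div, Complex.norm_I, Complex.norm_ofNat,
    Complex.norm_real, Real.norm_eq_abs, abs_of_pos (S.dens_pos z hz)]
  ring

theorem connAnti_ne_zero (hz : z ∈ puncturedDisc) (h0 : S.cubicCoeff z ≠ 0) :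
    S.connAnti z ≠ 0 := fun h => h0 (by simp [cubicCoeff_eq hz, h])

theorem hasDerivAt_cubicCoeff (hz : z ∈ puncturedDisc) :
    HasDerivAt S.cubicCoeff (-(Complex.I / 2) *
      (S.dens z * S.connHol z * S.connAnti z + S.dens z * wirtingerDeriv S.connAnti z)) z := by
  have heq : S.cubicCoeff =ᶠ[𝓝 z] fun w => -(Complex.I / 2) * (S.dens w * S.connAnti w) := by
    filter_upwards [isOpen_puncturedDisc.mem_nhds hz] with w hw using cubicCoeff_eq hw
  refine (((hasWirtingerDerivAt_dens hz).mul
    (hasWirtingerDerivAt_connAnti hz)).const_mul _ |>.congr_of_eventuallyEq heq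
    |>.congr_deriv rfl ?_).hasDerivAt
  ring

theorem wirtingerDeriv_connAnti (hz : z ∈ puncturedDisc) (h0 : S.cubicCoeff z ≠ 0) :
    wirtingerDeriv S.connAnti z = S.connAnti z * (logDeriv S.cubicCoeff z - S.connHol z) := by
  have hdens : (S.dens z : ℂ) ≠ 0 := Complex.ofReal_ne_zero.2 (S.dens_pos z hz).ne'
  have hb := connAnti_ne_zero hz h0
  rw [logDeriv_apply, (hasDerivAt_cubicCoeff hz).deriv, cubicCoeff_eq hz]
  field_simp [Complex.I_ne_zero]
  ring

end SpecialKahlerStructure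

theorem fderiv_re_of_hasDerivAt {f : ℂ → ℂ} {c z : ℂ} (h : HasDerivAt f c z) (X : ℂ) :
    fderiv ℝ (fun w => (f w).re) z X = (c * X).re := by
  have hre : HasFDerivAt (fun w => (f w).re) _ z :=
    Complex.reCLM.hasFDerivAt.comp z (h.hasFDerivAt.restrictScalars ℝ)
  rw [hre.fderiv]
  simp [mul_comm]

namespace SpecialKahlerStructure

/-- The holomorphic one-form `p dz` is the differential of a function with flat real part, i.e.
`Re (p dz)` is parallel for the connection that `∇` induces on one-forms. -/
def IsFlatDifferentialOn (S : SpecialKahlerStructure) (U : Set ℂ) (p : ℂ → ℂ) : Prop :=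
  ∀ z ∈ U, HasDerivAt p (S.connHol z * p z + S.connAnti z * conj (p z)) z

variable {S : SpecialKahlerStructure} {U : Set ℂ} {Z W p q : ℂ → ℂ} {z : ℂ}

theorem isFlatFunction_re_iff (hU : IsOpen U) (hsub : U ⊆ puncturedDisc)
    (hZ : ∀ w ∈ U, HasDerivAt Z (p w) w) :
    S.IsFlatFunction U (fun w => (Z w).re) ↔ S.IsFlatDifferentialOn U p := by
  have hp : ∀ w ∈ U, HasDerivAt p (deriv p w) w := fun w hw => by
    have hZd : DifferentiableOn ℂ Z U := fun v hv =>
      (hZ v hv).differentiableAt.differentiableWithinAt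
    have heq : Set.EqOn p (deriv Z) U := fun v hv => (hZ v hv).deriv.symm
    exact (((hZd.deriv hU).congr heq).differentiableAt (hU.mem_nhds hw)).hasDerivAt
  have hsnd : ∀ w ∈ U, ∀ X Y : ℂ,
      fderiv ℝ (fun v => fderiv ℝ (fun u => (Z u).re) v Y) w X = (deriv p w * Y * X).re := by
    intro w hw X Y
    have heq : (fun v => fderiv ℝ (fun u => (Z u).re) v Y) =ᶠ[𝓝 w] fun v => (p v * Y).re := by
      filter_upwards [hU.mem_nhds hw] with v hv using fderiv_re_of_hasDerivAt (hZ v hv) Y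
    rw [heq.fderiv_eq, fderiv_re_of_hasDerivAt ((hp w hw).mul_const Y)]
  have hconn : ∀ w ∈ U, ∀ X Y : ℂ, fderiv ℝ (fun u => (Z u).re) w (S.conn w X Y)
      = ((S.connHol w * p w + S.connAnti w * conj (p w)) * Y * X).re := by
    intro w hw X Y
    rw [fderiv_re_of_hasDerivAt (hZ w hw), conn_eq (hsub hw)]
    simp only [map_mul, Complex.mul_re, Complex.add_re, Complex.mul_im, Complex.conj_re,
      Complex.conj_im, Complex.add_im]
    ring
  refine forall₂_congr fun w hw => ?_
  simp only [hsnd w hw, hconn w hw]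
  constructor
  · intro h
    convert hp w hw using 1
    have h1 := h 1 1
    have hI := h 1 Complex.I
    simp only [mul_one, Complex.mul_I_re, neg_inj] at h1 hI
    exact (Complex.ext h1 hI).symm
  · intro h X Y
    rw [h.deriv]

theorem darboux_iff (hZ : HasDerivAt Z (p z) z) (hW : HasDerivAt W (q z) z) :
    (∀ X Y : ℂ, S.kahlerForm z X Y =
      -(fderiv ℝ (fun w => (Z w).re) z X * fderiv ℝ (fun w => (W w).re) z Y
        - fderiv ℝ (fun w => (Z w).re) z Y * fderiv ℝ (fun w => (W w).re) z X)) ↔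
      S.dens z = (conj (p z) * q z).im := by
  simp only [fderiv_re_of_hasDerivAt hZ, fderiv_re_of_hasDerivAt hW, kahlerForm, stdKahlerForm_eq]
  constructor
  · intro h
    have := h 1 Complex.I
    simp only [map_one, one_mul, Complex.I_im, mul_one, Complex.mul_re, Complex.I_re, mul_zero,
      Complex.mul_im, Complex.conj_re, Complex.conj_im] at this ⊢
    linarith
  · intro h X Y
    rw [h]
    simp only [Complex.mul_im, Complex.conj_re, Complex.conj_im, Complex.mul_re]
    ring

theorem isConjugateSpecialPair_iff (hU : IsOpen U) (hsub : U ⊆ puncturedDisc)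
    (hZ : ∀ w ∈ U, HasDerivAt Z (p w) w) (hW : ∀ w ∈ U, HasDerivAt W (q w) w) :
    S.IsConjugateSpecialPair U Z W ↔ S.IsFlatDifferentialOn U p ∧ S.IsFlatDifferentialOn U q ∧
      ∀ w ∈ U, S.dens w = (conj (p w) * q w).im := by
  rw [← isFlatFunction_re_iff hU hsub hZ, ← isFlatFunction_re_iff hU hsub hW]
  constructor
  · exact fun h => ⟨h.flat_Z, h.flat_W, fun w hw => (darboux_iff (hZ w hw) (hW w hw)).1
      (h.darboux w hw)⟩
  · exact fun ⟨flat_Z, flat_W, h⟩ =>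
      { isOpen := hU
        subset := hsub
        holo_Z w hw := (hZ w hw).differentiableAt.differentiableWithinAt
        holo_W w hw := (hW w hw).differentiableAt.differentiableWithinAt
        flat_Z := flat_Z
        flat_W := flat_W
        darboux w hw := (darboux_iff (hZ w hw) (hW w hw)).2 (h w hw) }

theorem IsFlatDifferentialOn.deriv_div (hp : S.IsFlatDifferentialOn U p)
    (hq : S.IsFlatDifferentialOn U q) (hz : z ∈ U) (hpz : p z ≠ 0) :
    deriv (fun w => q w / p w) z
      = -(2 * Complex.I * S.connAnti z * (conj (p z) * q z).im) / p z ^ 2 := by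
  rw [((hq z hz).fun_div (hp z hz) hpz).deriv, Complex.im_eq_sub_conj, map_mul, Complex.conj_conj]
  field_simp [Complex.I_ne_zero]
  ring

theorem IsConjugateSpecialPair.hyperbolicPullback_eq (h : S.IsConjugateSpecialPair U Z W)
    (hz : z ∈ U) :
    hyperbolicPullback (periodMap Z W) z = 16 * ‖S.cubicCoeff z‖ ^ 2 / S.dens z ^ 2 := by
  have hderiv {F : ℂ → ℂ} (hF : DifferentiableOn ℂ F U) (w : ℂ) (hw : w ∈ U) :=
    (hF.differentiableAt (h.isOpen.mem_nhds hw)).hasDerivAt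
  obtain ⟨hp, hq, hdens⟩ :=
    (isConjugateSpecialPair_iff h.isOpen h.subset (hderiv h.holo_Z) (hderiv h.holo_W)).1 h
  have hpos := S.dens_pos z (h.subset hz)
  have hpz : deriv Z z ≠ 0 := fun h0 => by simp [hdens z hz, h0] at hpos
  have hτ : deriv (periodMap Z W) z
      = -(2 * Complex.I * S.connAnti z * S.dens z) / deriv Z z ^ 2 := by
    rw [hdens z hz]
    exact hp.deriv_div hq hz hpz
  have him : (periodMap Z W z).im = S.dens z / ‖deriv Z z‖ ^ 2 := by
    rw [periodMap, hdens z hz, ← Complex.normSq_eq_norm_sq, Complex.div_im]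
    simp only [Complex.mul_im, Complex.conj_re, Complex.conj_im]
    ring
  have : ‖deriv Z z‖ ≠ 0 := norm_ne_zero_iff.2 hpz
  rw [hyperbolicPullback, hτ, him, norm_cubicCoeff (h.subset hz)]
  simp only [norm_mul, norm_neg, norm_div, Complex.norm_I, Complex.norm_real, norm_pow,
    Real.norm_eq_abs, abs_of_pos hpos, Complex.norm_ofNat]
  field_simp
  ring

theorem IsConjugateSpecialPair.hypDens_eq (h : S.IsConjugateSpecialPair U Z W) (hz : z ∈ U) :
    S.hypDens z = 16 * ‖S.cubicCoeff z‖ ^ 2 / S.dens z ^ 2 := by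
  obtain ⟨U', Z', W', hz', h', heq⟩ := Classical.epsilon_spec (p := fun c : ℝ =>
    ∃ (U : Set ℂ) (Z W : ℂ → ℂ),
      z ∈ U ∧ S.IsConjugateSpecialPair U Z W ∧ c = hyperbolicPullback (periodMap Z W) z)
    ⟨_, U, Z, W, hz, h, rfl⟩
  rw [hypDens, heq, h'.hyperbolicPullback_eq hz']

end SpecialKahlerStructure

section LinearODE

variable {E : Type*} [NormedAddCommGroup E] [NormedSpace ℂ E] {M : ℂ → E →L[ℂ] E} {z₀ : ℂ}
  {r K : ℝ} {v : E}

/-- `Y n` is the difference of two consecutive Picard iterates, based at `z₀`, of the linear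
equation `Y' = M Y` with initial value `v`; hence `∑ₙ Y n` is the solution. -/
structure IsPicardSequence (M : ℂ → E →L[ℂ] E) (z₀ : ℂ) (r : ℝ) (v : E) (Y : ℕ → ℂ → E) :
    Prop where
  zero : ∀ z, Y 0 z = v
  succ_base : ∀ n, Y (n + 1) z₀ = 0
  hasDerivAt_succ : ∀ n, ∀ z ∈ Metric.ball z₀ r, HasDerivAt (Y (n + 1)) (M z (Y n z)) z

theorem exists_isPicardSequence [CompleteSpace E] (hM : DifferentiableOn ℂ M (Metric.ball z₀ r))
    (v : E) : ∃ Y, IsPicardSequence M z₀ r v Y := by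
  have primitive (Y : {Y : ℂ → E // DifferentiableOn ℂ Y (Metric.ball z₀ r)}) :
      ∃ G : {Y : ℂ → E // DifferentiableOn ℂ Y (Metric.ball z₀ r)},
        G.1 z₀ = 0 ∧ ∀ z ∈ Metric.ball z₀ r, HasDerivAt G.1 (M z (Y.1 z)) z := by
    obtain ⟨G, hG0, hG⟩ := (hM.clm_apply Y.2).isExactOn_ball.with_val_at z₀ 0
    exact ⟨⟨G, fun z hz => (hG z hz).differentiableAt.differentiableWithinAt⟩, hG0, hG⟩
  choose F hF0 hF using primitive
  let Y (n : ℕ) := F^[n] ⟨fun _ => v, differentiableOn_const v⟩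
  have hY (n : ℕ) : Y (n + 1) = F (Y n) := Function.iterate_succ_apply' F n _
  exact ⟨fun n => (Y n).1, fun _ => rfl, fun n => by simp only [hY, hF0],
    fun n => by simpa only [hY] using hF (Y n)⟩

namespace IsPicardSequence

variable {Y : ℕ → ℂ → E}

theorem norm_le (hY : IsPicardSequence M z₀ r v Y) (hK : ∀ z ∈ Metric.ball z₀ r, ‖M z‖ ≤ K)
    (n : ℕ) {z : ℂ} (hz : z ∈ Metric.ball z₀ r) : ‖Y n z‖ ≤ (K * r) ^ n * ‖v‖ := by
  have hr : 0 < r := Metric.pos_of_mem_ball hz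
  have hz₀ : z₀ ∈ Metric.ball z₀ r := Metric.mem_ball_self hr
  have hK0 : 0 ≤ K := (norm_nonneg _).trans (hK z₀ hz₀)
  induction n generalizing z with
  | zero => simp [hY.zero]
  | succ n ih =>
    have h := (convex_ball z₀ r).norm_image_sub_le_of_norm_hasDerivWithin_le
      (fun x hx => (hY.hasDerivAt_succ n x hx).hasDerivWithinAt)
      (fun x hx => (M x).le_of_opNorm_le_of_le (hK x hx) (ih hx)) hz₀ hz
    rw [hY.succ_base, sub_zero] at h
    calc ‖Y (n + 1) z‖ ≤ K * ((K * r) ^ n * ‖v‖) * ‖z - z₀‖ := h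
      _ ≤ K * ((K * r) ^ n * ‖v‖) * r := by gcongr; exact (mem_ball_iff_norm.1 hz).le
      _ = (K * r) ^ (n + 1) * ‖v‖ := by ring

theorem hasDerivAt_tsum [CompleteSpace E] (hY : IsPicardSequence M z₀ r v Y)
    (hK : ∀ z ∈ Metric.ball z₀ r, ‖M z‖ ≤ K) (hKr : K * r < 1) {z : ℂ}
    (hz : z ∈ Metric.ball z₀ r) :
    HasDerivAt (fun w => v + ∑' n, Y (n + 1) w) (M z (v + ∑' n, Y (n + 1) z)) z := by
  have hr : 0 < r := Metric.pos_of_mem_ball hz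
  have hz₀ : z₀ ∈ Metric.ball z₀ r := Metric.mem_ball_self hr
  have hK0 : 0 ≤ K := (norm_nonneg _).trans (hK z₀ hz₀)
  have hgeom : Summable fun n : ℕ => (K * r) ^ n * ‖v‖ :=
    (summable_geometric_of_lt_one (by positivity) hKr).mul_right _
  have hsum : Summable fun n => Y n z :=
    Summable.of_norm_bounded hgeom fun n => hY.norm_le hK n hz
  have hderiv := hasDerivAt_tsum_of_isPreconnected (hgeom.mul_left K) Metric.isOpen_ball
    (convex_ball z₀ r).isPreconnected hY.hasDerivAt_succ
    (fun n x hx => (M x).le_of_opNorm_le_of_le (hK x hx) (hY.norm_le hK n hx)) hz₀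
    (by simp [hY.succ_base]) hz
  rw [← hY.zero z, ← hsum.tsum_eq_zero_add, (M z).map_tsum hsum]
  exact hderiv.const_add _

end IsPicardSequence

theorem exists_ball_forall_exists_hasDerivAt_linear [CompleteSpace E] {U : Set ℂ}
    (hU : IsOpen U) (hM : DifferentiableOn ℂ M U) (hz₀ : z₀ ∈ U) :
    ∃ r > 0, Metric.ball z₀ r ⊆ U ∧
      ∀ v, ∃ Y : ℂ → E, Y z₀ = v ∧ ∀ z ∈ Metric.ball z₀ r, HasDerivAt Y (M z (Y z)) z := by
  have hMcont : ContinuousAt M z₀ := (hM.differentiableAt (hU.mem_nhds hz₀)).continuousAt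
  obtain ⟨δ, hδ, hball⟩ := Metric.eventually_nhds_iff_ball.1
    ((hMcont.norm.eventually_lt_const (lt_add_one ‖M z₀‖)).and (hU.mem_nhds hz₀))
  set K := ‖M z₀‖ + 1
  have hK : 0 < K := by positivity
  refine ⟨min δ (1 / (2 * K)), by positivity, ?_, fun v => ?_⟩
  · exact fun z hz => (hball z (Metric.ball_subset_ball (min_le_left _ _) hz)).2
  obtain ⟨Y, hY⟩ := exists_isPicardSequence (r := min δ (1 / (2 * K))) (hM.mono
    fun z hz => (hball z (Metric.ball_subset_ball (min_le_left _ _) hz)).2) v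
  have hKr : K * min δ (1 / (2 * K)) < 1 :=
    calc K * min δ (1 / (2 * K)) ≤ K * (1 / (2 * K)) := by gcongr; exact min_le_right _ _
      _ < 1 := by field_simp; norm_num
  exact ⟨fun z => v + ∑' n, Y (n + 1) z, by simp [hY.succ_base], fun z hz => hY.hasDerivAt_tsum
    (fun w hw => (hball w (Metric.ball_subset_ball (min_le_left _ _) hw)).1.le) hKr hz⟩

end LinearODE

theorem exists_ball_forall_exists_hasDerivAt_secondOrder {U : Set ℂ} {Q L : ℂ → ℂ} {z₀ : ℂ}
    (hU : IsOpen U) (hQ : DifferentiableOn ℂ Q U) (hL : DifferentiableOn ℂ L U) (hz₀ : z₀ ∈ U) :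
    ∃ r > 0, Metric.ball z₀ r ⊆ U ∧ ∀ v v₁ : ℂ, ∃ p p₁ : ℂ → ℂ, p z₀ = v ∧ p₁ z₀ = v₁ ∧
      ∀ z ∈ Metric.ball z₀ r,
        HasDerivAt p (p₁ z) z ∧ HasDerivAt p₁ (Q z * p z + L z * p₁ z) z := by
  let fst := ContinuousLinearMap.fst ℂ ℂ ℂ
  let snd := ContinuousLinearMap.snd ℂ ℂ ℂ
  let M (z : ℂ) : ℂ × ℂ →L[ℂ] ℂ × ℂ :=
    (ContinuousLinearMap.inl ℂ ℂ ℂ).comp snd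
      + (Q z • (ContinuousLinearMap.inr ℂ ℂ ℂ).comp fst
        + L z • (ContinuousLinearMap.inr ℂ ℂ ℂ).comp snd)
  have hM : DifferentiableOn ℂ M U :=
    (differentiableOn_const _).add ((hQ.smul_const _).add (hL.smul_const _))
  obtain ⟨r, hr, hball, hsol⟩ := exists_ball_forall_exists_hasDerivAt_linear hU hM hz₀
  refine ⟨r, hr, hball, fun v v₁ => ?_⟩
  obtain ⟨Y, hY₀, hY⟩ := hsol (v, v₁)
  refine ⟨fun z => (Y z).1, fun z => (Y z).2, by simp [hY₀], by simp [hY₀], fun z hz => ⟨?_, ?_⟩⟩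
  · simpa [M, fst, snd, Function.comp_def] using fst.hasFDerivAt.comp_hasDerivAt z (hY z hz)
  · simpa [M, fst, snd, Function.comp_def] using snd.hasFDerivAt.comp_hasDerivAt z (hY z hz)

namespace SpecialKahlerStructure

variable {S : SpecialKahlerStructure} {s : Set ℂ} {p p₁ q : ℂ → ℂ} {z z₀ : ℂ}

/-- The points of the punctured disc where the cubic form does not vanish; near these the flat
differentials are the solutions of a holomorphic differential equation. -/
def nonzeroLocus (S : SpecialKahlerStructure) : Set ℂ := puncturedDisc ∩ {z | S.cubicCoeff z ≠ 0}

theorem differentiableOn_cubicCoeff : DifferentiableOn ℂ S.cubicCoeff puncturedDisc :=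
  fun _ hz => (hasDerivAt_cubicCoeff hz).differentiableAt.differentiableWithinAt

theorem isOpen_nonzeroLocus : IsOpen S.nonzeroLocus :=
  differentiableOn_cubicCoeff.continuousOn.isOpen_inter_preimage isOpen_puncturedDisc
    isOpen_compl_singleton

theorem differentiableOn_logDeriv_cubicCoeff :
    DifferentiableOn ℂ (logDeriv S.cubicCoeff) S.nonzeroLocus :=
  ((differentiableOn_cubicCoeff.deriv isOpen_puncturedDisc).mono Set.inter_subset_left).div
    (differentiableOn_cubicCoeff.mono Set.inter_subset_left) fun _ hz => hz.2

/-- Differentiating `p' = a p + b p̄` eliminates `p̄` where the cubic form does not vanish, and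
yields `p'' = Q p + (Ξ₀' / Ξ₀) p'` with this coefficient `Q`. -/
noncomputable def flatCoeff (S : SpecialKahlerStructure) (z : ℂ) : ℂ :=
  wirtingerDeriv S.connHol z + S.connHol z * S.connHol z
    - S.connHol z * logDeriv S.cubicCoeff z

theorem hasWirtingerDerivAt_connAnti_of_mem_nonzeroLocus (hz : z ∈ S.nonzeroLocus) :
    HasWirtingerDerivAt S.connAnti (S.connAnti z * (logDeriv S.cubicCoeff z - S.connHol z))
      (-(conj (S.connHol z) * S.connAnti z)) z :=
  wirtingerDeriv_connAnti hz.1 hz.2 ▸ hasWirtingerDerivAt_connAnti hz.1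

theorem hasDerivAt_logDeriv_cubicCoeff (hz : z ∈ S.nonzeroLocus) :
    HasDerivAt (logDeriv S.cubicCoeff) (deriv (logDeriv S.cubicCoeff) z) z :=
  (differentiableOn_logDeriv_cubicCoeff.differentiableAt
    (isOpen_nonzeroLocus.mem_nhds hz)).hasDerivAt

theorem differentiableOn_flatCoeff : DifferentiableOn ℂ S.flatCoeff S.nonzeroLocus := by
  intro z hz
  have ha := hasWirtingerDerivAt_connHol (S := S) hz.1
  have hb := hasWirtingerDerivAt_connAnti_of_mem_nonzeroLocus hz
  have hda : HasWirtingerDerivAt (wirtingerDeriv S.connHol) _ _ z := .of_differentiableAt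
    ((contDiffOn_wirtingerDeriv contDiffOn_connHol isOpen_puncturedDisc).contDiffAt
      (isOpen_puncturedDisc.mem_nhds hz.1) |>.differentiableAt (by simp))
  have hmixed := HasWirtingerDerivAt.mixed_deriv_eq
    (by filter_upwards [isOpen_puncturedDisc.mem_nhds hz.1] with w hw
          using hasWirtingerDerivAt_connHol hw)
    hda ((hb.mul hb.star).const_mul (-1) |>.congr_of_eventuallyEq (by simp))
  have hL := HasWirtingerDerivAt.of_hasDerivAt (hasDerivAt_logDeriv_cubicCoeff hz)
  refine ((hda.add (ha.mul ha)).sub (ha.mul hL) |>.congr_deriv rfl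
    ?_).hasDerivAt.differentiableAt.differentiableWithinAt
  rw [hmixed]
  simp only [map_neg, map_mul, Complex.conj_conj]
  ring

theorem isFlatDifferentialOn_of_secondOrder (hs : StarConvex ℝ z₀ s) (hsub : s ⊆ S.nonzeroLocus)
    (hp : ∀ z ∈ s, HasDerivAt p (p₁ z) z)
    (hp₁ : ∀ z ∈ s, HasDerivAt p₁ (S.flatCoeff z * p z + logDeriv S.cubicCoeff z * p₁ z) z)
    (h₀ : p₁ z₀ = S.connHol z₀ * p z₀ + S.connAnti z₀ * conj (p z₀)) :
    S.IsFlatDifferentialOn s p := by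
  let defect (z : ℂ) := p₁ z - (S.connHol z * p z + S.connAnti z * conj (p z))
  have hdefect : ∀ z ∈ s, HasWirtingerDerivAt defect
      ((logDeriv S.cubicCoeff z - S.connHol z) * defect z)
      (-S.connAnti z * conj (defect z)) z := by
    intro z hz
    have hpz := HasWirtingerDerivAt.of_hasDerivAt (hp z hz)
    refine (HasWirtingerDerivAt.of_hasDerivAt (hp₁ z hz)).sub
      (((hasWirtingerDerivAt_connHol (hsub hz).1).mul hpz).add
        ((hasWirtingerDerivAt_connAnti_of_mem_nonzeroLocus (hsub hz)).mul hpz.star))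
      |>.congr_deriv ?_ ?_
    · simp only [defect, flatCoeff, map_zero]
      ring
    · simp only [defect, map_sub, map_add, map_mul, Complex.conj_conj]
      ring
  have hcont : ContinuousOn
      (fun z => ‖logDeriv S.cubicCoeff z - S.connHol z‖ + ‖S.connAnti z‖) s :=
    ((differentiableOn_logDeriv_cubicCoeff.continuousOn.sub
      (contDiffOn_connHol.continuousOn.mono Set.inter_subset_left)).norm.add
      (contDiffOn_connAnti.continuousOn.mono Set.inter_subset_left).norm).mono hsub
  intro z hz
  have hzero : defect z = 0 := eq_zero_of_hasWirtingerDerivAt hs hdefect hcont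
    (fun w _ => by simp [add_mul]) (sub_eq_zero.2 h₀) hz
  exact sub_eq_zero.1 hzero ▸ hp z hz

theorem IsFlatDifferentialOn.dens_eq (hs : StarConvex ℝ z₀ s) (hsub : s ⊆ puncturedDisc)
    (hp : S.IsFlatDifferentialOn s p) (hq : S.IsFlatDifferentialOn s q)
    (h₀ : S.dens z₀ = (conj (p z₀) * q z₀).im) (hz : z ∈ s) :
    S.dens z = (conj (p z) * q z).im := by
  let defect (z : ℂ) := conj (p z) * q z - p z * conj (q z) - 2 * Complex.I * S.dens z
  have hiff (w : ℂ) : S.dens w = (conj (p w) * q w).im ↔ defect w = 0 := by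
    rw [← Complex.ofReal_inj, Complex.im_eq_sub_conj, map_mul, Complex.conj_conj,
      eq_div_iff (by simp), eq_comm, ← sub_eq_zero, mul_comm (S.dens w : ℂ)]
  have hdefect : ∀ z ∈ s, HasWirtingerDerivAt defect (S.connHol z * defect z)
      (conj (S.connHol z) * defect z) z := by
    intro z hz
    have hpz := HasWirtingerDerivAt.of_hasDerivAt (hp z hz)
    have hqz := HasWirtingerDerivAt.of_hasDerivAt (hq z hz)
    refine ((hpz.star.mul hqz).sub (hpz.mul hqz.star)).sub
      ((hasWirtingerDerivAt_dens (hsub hz)).const_mul (2 * Complex.I)) |>.congr_deriv ?_ ?_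
    · simp only [defect, map_zero]
      ring
    · simp only [defect, map_add, map_mul, Complex.conj_conj]
      ring
  rw [hiff] at h₀ ⊢
  have hcont : ContinuousOn (fun z => 2 * ‖S.connHol z‖) s :=
    continuousOn_const.mul (contDiffOn_connHol.continuousOn.norm.mono hsub)
  exact eq_zero_of_hasWirtingerDerivAt hs hdefect hcont
    (fun w _ => by simp [two_mul, add_mul]) h₀ hz

theorem exists_isConjugateSpecialPair (hz₀ : z₀ ∈ S.nonzeroLocus) :
    ∃ (U : Set ℂ) (Z W : ℂ → ℂ), z₀ ∈ U ∧ S.IsConjugateSpecialPair U Z W := by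
  obtain ⟨r, hr, hball, hsol⟩ := exists_ball_forall_exists_hasDerivAt_secondOrder
    isOpen_nonzeroLocus differentiableOn_flatCoeff differentiableOn_logDeriv_cubicCoeff hz₀
  have hz₀r : z₀ ∈ Metric.ball z₀ r := Metric.mem_ball_self hr
  have hstar : StarConvex ℝ z₀ (Metric.ball z₀ r) := (convex_ball z₀ r).starConvex hz₀r
  have hdisc := hball.trans Set.inter_subset_left
  have hflat (v : ℂ) : ∃ p, p z₀ = v ∧ S.IsFlatDifferentialOn (Metric.ball z₀ r) p := by
    obtain ⟨p, p₁, hp₀, hp₁₀, hp⟩ := hsol v (S.connHol z₀ * v + S.connAnti z₀ * conj v)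
    exact ⟨p, hp₀, isFlatDifferentialOn_of_secondOrder hstar hball (fun z hz => (hp z hz).1)
      (fun z hz => (hp z hz).2) (hp₀ ▸ hp₁₀)⟩
  obtain ⟨p, hp₀, hp⟩ := hflat 1
  obtain ⟨q, hq₀, hq⟩ := hflat (Complex.I * S.dens z₀)
  have hprimitive {f : ℂ → ℂ} (hf : S.IsFlatDifferentialOn (Metric.ball z₀ r) f) :
      ∃ F, ∀ z ∈ Metric.ball z₀ r, HasDerivAt F (f z) z :=
    DifferentiableOn.isExactOn_ball fun z hz => (hf z hz).differentiableAt.differentiableWithinAt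
  obtain ⟨Z, hZ⟩ := hprimitive hp
  obtain ⟨W, hW⟩ := hprimitive hq
  exact ⟨_, Z, W, hz₀r, (isConjugateSpecialPair_iff Metric.isOpen_ball hdisc hZ hW).2
    ⟨hp, hq, fun z hz => hp.dens_eq hstar hdisc hq (by simp [hp₀, hq₀]) hz⟩⟩

theorem hypDens_eq (hz : z ∈ S.nonzeroLocus) :
    S.hypDens z = 16 * ‖S.cubicCoeff z‖ ^ 2 / S.dens z ^ 2 := by
  obtain ⟨U, Z, W, hzU, h⟩ := exists_isConjugateSpecialPair hz
  exact h.hypDens_eq hzU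

theorem laplacian_log_dens_eq_neg_hypDens (hz : z ∈ S.nonzeroLocus) :
    Δ (fun w => Real.log (S.dens w)) z = -S.hypDens z := by
  have hdens := (S.dens_pos z hz.1).ne'
  rw [laplacian_log_dens hz.1, hypDens_eq hz, norm_cubicCoeff hz.1]
  field_simp
  ring

end SpecialKahlerStructure

section MaximumPrinciple

theorem iteratedFDeriv_two_nonpos_of_isLocalMax {E : Type*} [NormedAddCommGroup E]
    [NormedSpace ℝ E] {f : E → ℝ} {x : E} (hf : ContDiffAt ℝ 2 f x) (hmax : IsLocalMax f x)
    (e : E) : iteratedFDeriv ℝ 2 f x ![e, e] ≤ 0 := by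
  set line : ℝ → E := fun t => x + t • e
  have hline (t : ℝ) : HasDerivAt line e t :=
    (((hasDerivAt_id' t).smul_const e).const_add x).congr_deriv (one_smul ℝ e)
  have hline_zero : line 0 = x := by simp [line]
  have htendsto : Tendsto line (𝓝 0) (𝓝 x) := hline_zero ▸ (hline 0).continuousAt
  have hderiv : ∀ᶠ t in 𝓝 0, HasDerivAt (f ∘ line) (fderiv ℝ f (line t) e) t := by
    filter_upwards [htendsto.eventually (hf.eventually (by simp))] with t ht
    exact (ht.differentiableAt two_ne_zero).hasFDerivAt.comp_hasDerivAt t (hline t)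
  have hderiv₂ : deriv (deriv (f ∘ line)) 0 = iteratedFDeriv ℝ 2 f x ![e, e] := by
    have hf' : DifferentiableAt ℝ (fderiv ℝ f) (line 0) := by
      rw [hline_zero]
      exact (hf.fderiv_right (m := 1) le_rfl).differentiableAt one_ne_zero
    have hslope : deriv (f ∘ line) =ᶠ[𝓝 0] fun t => fderiv ℝ f (line t) e :=
      hderiv.mono fun t ht => ht.deriv
    have h := (hf'.hasFDerivAt.comp_hasDerivAt 0 (hline 0)).clm_apply (hasDerivAt_const 0 e)
    rw [hslope.deriv_eq, iteratedFDeriv_two_apply]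
    simpa [hline_zero] using h.deriv
  by_contra! hpos
  have hφmax : IsLocalMax (f ∘ line) 0 := by
    filter_upwards [htendsto.eventually hmax] with t ht
    simpa only [Function.comp_apply, hline_zero] using ht
  have hφmin : IsLocalMin (f ∘ line) 0 := isLocalMin_of_deriv_deriv_pos (hderiv₂ ▸ hpos)
    hφmax.deriv_eq_zero hderiv.self_of_nhds.continuousAt
  have hconst : f ∘ line =ᶠ[𝓝 0] fun _ => f (line 0) := by
    filter_upwards [hφmax, hφmin] with t hle hge using le_antisymm hle hge
  rw [← hderiv₂, hconst.deriv.deriv_eq, deriv_const', deriv_const] at hpos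
  exact hpos.false

variable {E : Type*} [NormedAddCommGroup E] [InnerProductSpace ℝ E] [FiniteDimensional ℝ E]

theorem laplacian_nonpos_of_isLocalMax {f : E → ℝ} {x : E} (hf : ContDiffAt ℝ 2 f x)
    (hmax : IsLocalMax f x) : Δ f x ≤ 0 := by
  rw [InnerProductSpace.laplacian_eq_iteratedFDeriv_stdOrthonormalBasis]
  exact Finset.sum_nonpos fun i _ => iteratedFDeriv_two_nonpos_of_isLocalMax hf hmax _

theorem le_of_laplacian_pos_of_frontier_le {f : E → ℝ} {K : Set E} {m : ℝ} (hK : IsCompact K)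
    (hcont : ContinuousOn f K) (hf : ∀ x ∈ interior K, ContDiffAt ℝ 2 f x)
    (hΔ : ∀ x ∈ interior K, 0 < Δ f x) (hm : ∀ x ∈ frontier K, f x ≤ m) {x : E} (hx : x ∈ K) :
    f x ≤ m := by
  obtain ⟨p, hp, hmax⟩ := hK.exists_isMaxOn ⟨x, hx⟩ hcont
  have hp_int : p ∉ interior K := fun hint =>
    (hΔ p hint).not_ge <| laplacian_nonpos_of_isLocalMax (hf p hint)
      (hmax.isLocalMax (mem_interior_iff_mem_nhds.1 hint))
  exact (hmax hx).trans (hm p ⟨subset_closure hp, hp_int⟩)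

theorem laplacian_add_const_mul {f g : E → ℝ} {x : E} (hf : ContDiffAt ℝ 2 f x)
    (hg : ContDiffAt ℝ 2 g x) (t : ℝ) : Δ (fun y => f y + t * g y) x = Δ f x + t * Δ g x := by
  have hg' : ContDiffAt ℝ 2 (t • g) x := hg.const_smul t
  rw [← smul_eq_mul, ← InnerProductSpace.laplacian_smul t hg, ← hf.laplacian_add hg']
  rfl

end MaximumPrinciple

section PuncturedDisc

theorem le_of_laplacian_pos_of_tendsto_atBot {f : ℂ → ℝ} {R m : ℝ}
    (hf : ∀ z, 0 < ‖z‖ → ‖z‖ ≤ R → ContDiffAt ℝ 2 f z) (hΔ : ∀ z, 0 < ‖z‖ → ‖z‖ ≤ R → 0 < Δ f z)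
    (hbot : Tendsto f (𝓝[≠] 0) atBot) (hm : ∀ z, ‖z‖ = R → f z ≤ m) {z : ℂ} (hz : 0 < ‖z‖)
    (hzR : ‖z‖ ≤ R) : f z ≤ m := by
  obtain ⟨ε, hε, hsmall⟩ := Metric.eventually_nhds_iff_ball.1
    (eventually_nhdsWithin_iff.1 (hbot.eventually_le_atBot m))
  set ρ := min (ε / 2) ‖z‖
  have hρ : 0 < ρ := by positivity
  have hK : IsCompact {w : ℂ | ρ ≤ ‖w‖ ∧ ‖w‖ ≤ R} :=
    (isCompact_closedBall (0 : ℂ) R).of_isClosed_subset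
      ((isClosed_le continuous_const continuous_norm).inter
        (isClosed_le continuous_norm continuous_const)) fun w hw => by simpa using hw.2
  have hfrontier : ∀ w ∈ frontier {w : ℂ | ρ ≤ ‖w‖ ∧ ‖w‖ ≤ R}, f w ≤ m := by
    intro w hw
    rcases frontier_inter_subset _ _ hw with h | h
    · have hwρ : ρ = ‖w‖ := frontier_le_subset_eq continuous_const continuous_norm h.1
      exact hsmall w (mem_ball_zero_iff.2 (hwρ ▸ (min_le_left _ _).trans_lt (half_lt_self hε)))
        (norm_pos_iff.1 (hwρ ▸ hρ))
    · exact hm w (frontier_le_subset_eq continuous_norm continuous_const h.2)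
  exact le_of_laplacian_pos_of_frontier_le hK
    (fun w hw => (hf w (hρ.trans_le hw.1) hw.2).continuousAt.continuousWithinAt)
    (fun w hw => hf w (hρ.trans_le (interior_subset hw).1) (interior_subset hw).2)
    (fun w hw => hΔ w (hρ.trans_le (interior_subset hw).1) (interior_subset hw).2)
    hfrontier ⟨min_le_right _ _, hzR⟩

theorem contDiffAt_log_norm {z : ℂ} (hz : z ≠ 0) :
    ContDiffAt ℝ 2 (fun w : ℂ => Real.log ‖w‖) z :=
  (analyticAt_id.harmonicAt_log_norm hz).1

theorem laplacian_log_norm {z : ℂ} (hz : z ≠ 0) : Δ (fun w : ℂ => Real.log ‖w‖) z = 0 :=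
  (analyticAt_id.harmonicAt_log_norm hz).2.self_of_nhds

theorem tendsto_log_norm_nhdsNE : Tendsto (fun z : ℂ => Real.log ‖z‖) (𝓝[≠] 0) atBot :=
  Real.tendsto_log_nhdsGT_zero.comp tendsto_norm_nhdsNE_zero

theorem exists_forall_norm_le_of_eventually_nhdsNE {p : ℂ → Prop} (hp : ∀ᶠ z in 𝓝[≠] 0, p z) :
    ∃ R > 0, ∀ z, 0 < ‖z‖ → ‖z‖ ≤ R → p z := by
  obtain ⟨ε, hε, h⟩ := Metric.eventually_nhds_iff_ball.1 (eventually_nhdsWithin_iff.1 hp)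
  exact ⟨ε / 2, half_pos hε, fun z hz hzR => h z (by simpa using hzR.trans_lt (half_lt_self hε))
    (norm_pos_iff.1 hz)⟩

theorem eventually_norm_le_nhdsNE {R : ℝ} (hR : 0 < R) : ∀ᶠ z : ℂ in 𝓝[≠] 0, 0 < ‖z‖ ∧ ‖z‖ ≤ R := by
  filter_upwards [self_mem_nhdsWithin, nhdsWithin_le_nhds (Metric.closedBall_mem_nhds 0 hR)]
    with z hz0 hz
  exact ⟨norm_pos_iff.2 hz0, by simpa using hz⟩

theorem exists_forall_add_mul_log_norm_le {f : ℂ → ℝ} (hf : ∀ᶠ z in 𝓝[≠] 0, ContDiffAt ℝ 2 f z)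
    (hΔ : ∀ᶠ z in 𝓝[≠] 0, 0 < Δ f z) :
    ∃ R > 0, ∃ m, ∀ t, Tendsto (fun z => f z + t * Real.log ‖z‖) (𝓝[≠] 0) atBot →
      ∀ z, 0 < ‖z‖ → ‖z‖ ≤ R → f z + t * Real.log ‖z‖ ≤ m + t * Real.log R := by
  obtain ⟨R, hR, h⟩ := exists_forall_norm_le_of_eventually_nhdsNE (hf.and hΔ)
  have hcont : ContinuousOn f (Metric.sphere 0 R) := fun z hz => by
    have hzR : ‖z‖ = R := by simpa using hz
    exact (h z (hzR ▸ hR) hzR.le).1.continuousAt.continuousWithinAt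
  obtain ⟨m, hm⟩ := (isCompact_sphere (0 : ℂ) R).bddAbove_image hcont
  refine ⟨R, hR, m, fun t hbot z hz hzR => le_of_laplacian_pos_of_tendsto_atBot
    (fun w hw hwR => (h w hw hwR).1.add
      (contDiffAt_const.mul (contDiffAt_log_norm (norm_pos_iff.1 hw)))) (fun w hw hwR => ?_)
    hbot (fun w hw => ?_) hz hzR⟩
  · rw [laplacian_add_const_mul (h w hw hwR).1 (contDiffAt_log_norm (norm_pos_iff.1 hw)),
      laplacian_log_norm (norm_pos_iff.1 hw), mul_zero, add_zero]
    exact (h w hw hwR).2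
  · rw [hw]
    gcongr
    exact hm ⟨w, by simpa using hw, rfl⟩

theorem hasWirtingerDerivAt_norm_sq (z : ℂ) :
    HasWirtingerDerivAt (fun w => ((‖w‖ ^ 2 : ℝ) : ℂ)) (conj z) (conj (conj z)) z := by
  have hid := HasWirtingerDerivAt.of_hasDerivAt (hasDerivAt_id' z)
  simp only [← Complex.normSq_eq_norm_sq, Complex.normSq_eq_conj_mul_self]
  exact (hid.star.mul hid).congr_deriv (by simp) (by simp)

theorem hasWirtingerDerivAt_log_norm {z : ℂ} (hz : z ≠ 0) :
    HasWirtingerDerivAt (fun w => (Real.log ‖w‖ : ℂ)) (1 / (2 * z)) (conj (1 / (2 * z))) z := by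
  have hz' : conj z ≠ 0 := (map_ne_zero _).2 hz
  have hlog := ((hasWirtingerDerivAt_norm_sq z).log (by positivity)).const_mul (1 / 2)
  simp only [Real.log_pow] at hlog
  have hnorm : ((‖z‖ ^ 2 : ℝ) : ℂ) = conj z * z := by
    rw [← Complex.normSq_eq_norm_sq, Complex.normSq_eq_conj_mul_self]
  refine (hlog.congr_of_eventuallyEq (.of_forall fun w => ?_)).congr_deriv ?_ ?_
  · push_cast; ring
  · rw [hnorm]; field_simp
  · rw [hnorm, map_div₀, map_one, map_mul, Complex.conj_ofNat, Complex.conj_conj]; field_simp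

theorem laplacian_norm_sq (z : ℂ) : Δ (fun w : ℂ => ‖w‖ ^ 2) z = 4 := by
  have hconj := (HasWirtingerDerivAt.of_hasDerivAt (hasDerivAt_id' z)).star
  rw [HasWirtingerDerivAt.laplacian_eq (.of_forall hasWirtingerDerivAt_norm_sq) hconj]
  simp

theorem laplacian_log_norm_sq {z : ℂ} (hz : z ≠ 0) :
    Δ (fun w : ℂ => Real.log ‖w‖ ^ 2) z = 2 / ‖z‖ ^ 2 := by
  have hz' : conj z ≠ 0 := (map_ne_zero _).2 hz
  have hgrad : ∀ᶠ w in 𝓝 z, HasWirtingerDerivAt (fun v => ((Real.log ‖v‖ ^ 2 : ℝ) : ℂ))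
      (Real.log ‖w‖ * w⁻¹) (conj (Real.log ‖w‖ * w⁻¹)) w := by
    filter_upwards [isOpen_ne.mem_nhds hz] with w hw
    have hlog := hasWirtingerDerivAt_log_norm hw
    simp only [pow_two, Complex.ofReal_mul]
    refine (hlog.mul hlog).congr_deriv (by ring) ?_
    simp only [map_mul, map_div₀, map_one, map_inv₀, Complex.conj_ofReal, Complex.conj_ofNat]
    ring
  have hgrad' := (hasWirtingerDerivAt_log_norm hz).mul (.of_hasDerivAt (hasDerivAt_inv hz))
  have hβ : conj (1 / (2 * z)) * z⁻¹ + (Real.log ‖z‖ : ℂ) * 0 = ((1 / (2 * ‖z‖ ^ 2) : ℝ) : ℂ) := by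
    rw [← Complex.normSq_eq_norm_sq]
    push_cast
    rw [Complex.normSq_eq_conj_mul_self, map_div₀, map_mul, map_one, Complex.conj_ofNat]
    field_simp
    ring
  rw [HasWirtingerDerivAt.laplacian_eq hgrad hgrad', hβ, Complex.ofReal_re]
  field_simp
  norm_num

/- `f - (c / 4) log² |z|` is still strictly subharmonic and stays bounded above near the puncture
after any multiple of `log |z|` is added. -/
theorem not_isBoundedUnder_le_of_div_norm_sq_le_laplacian {f : ℂ → ℝ} {c : ℝ} (hc : 0 < c)
    (hf : ∀ᶠ z in 𝓝[≠] 0, ContDiffAt ℝ 2 f z) (hΔ : ∀ᶠ z in 𝓝[≠] 0, c / ‖z‖ ^ 2 ≤ Δ f z) :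
    ¬ IsBoundedUnder (· ≤ ·) (𝓝[≠] 0) f := by
  rintro ⟨B, hB⟩
  rw [eventually_map] at hB
  set g : ℂ → ℝ := fun z => f z + -(c / 4) * Real.log ‖z‖ ^ 2
  have hlog_sq {z : ℂ} (hz : z ≠ 0) : ContDiffAt ℝ 2 (fun w : ℂ => Real.log ‖w‖ ^ 2) z :=
    (contDiffAt_log_norm hz).pow 2
  have hg : ∀ᶠ z in 𝓝[≠] 0, ContDiffAt ℝ 2 g z := by
    filter_upwards [hf, self_mem_nhdsWithin] with z hz hz0
    exact hz.add (contDiffAt_const.mul (hlog_sq hz0))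
  have hΔg : ∀ᶠ z in 𝓝[≠] 0, 0 < Δ g z := by
    filter_upwards [hf, hΔ, self_mem_nhdsWithin] with z hz hΔz hz0
    have hpos : 0 < c / ‖z‖ ^ 2 := div_pos hc (pow_pos (norm_pos_iff.2 hz0) 2)
    rw [laplacian_add_const_mul hz (hlog_sq hz0), laplacian_log_norm_sq hz0]
    ring_nf at hpos hΔz ⊢
    linarith
  obtain ⟨R, hR, m, hm⟩ := exists_forall_add_mul_log_norm_le hg hΔg
  have hbot (t : ℝ) : Tendsto (fun z => g z + t * Real.log ‖z‖) (𝓝[≠] 0) atBot := by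
    have hquad : Tendsto (fun x : ℝ => x * (c / 4 * x - t)) atBot atTop :=
      tendsto_id.atBot_mul_atBot₀
        (tendsto_atBot_add_const_right _ (-t) (tendsto_id.const_mul_atBot (by positivity)))
    refine tendsto_atBot_mono' _ ?_ (tendsto_atBot_add_const_left _ B
      (tendsto_neg_atTop_atBot.comp (hquad.comp tendsto_log_norm_nhdsNE)))
    filter_upwards [hB] with z hz
    simp only [g, Function.comp_apply]
    linarith
  have hz : ‖((R / 2 : ℝ) : ℂ)‖ = R / 2 := by
    rw [Complex.norm_real, Real.norm_of_nonneg (by positivity)]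
  have hlog : 0 < Real.log R - Real.log (R / 2) :=
    sub_pos.2 (Real.log_lt_log (by positivity) (half_lt_self hR))
  set t := (g (R / 2 : ℝ) - m - 1) / (Real.log R - Real.log (R / 2))
  have ht : t * (Real.log R - Real.log (R / 2)) = g (R / 2 : ℝ) - m - 1 :=
    div_mul_cancel₀ _ hlog.ne'
  have hle := hm t (hbot t) (R / 2 : ℝ) (by rw [hz]; positivity) (by rw [hz]; linarith)
  rw [hz] at hle
  linarith

theorem isBoundedUnder_ge_of_laplacian_le {f : ℂ → ℝ} {M : ℝ}
    (hf : ∀ᶠ z in 𝓝[≠] 0, ContDiffAt ℝ 2 f z) (hΔ : ∀ᶠ z in 𝓝[≠] 0, Δ f z ≤ M)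
    (hlittle : f =o[𝓝[≠] 0] fun z => Real.log ‖z‖) : IsBoundedUnder (· ≥ ·) (𝓝[≠] 0) f := by
  set A := |M| + 1
  have hsq (z : ℂ) : ContDiffAt ℝ 2 (fun w : ℂ => ‖w‖ ^ 2) z := (contDiff_norm_sq ℝ).contDiffAt
  set g : ℂ → ℝ := fun z => -f z + A * ‖z‖ ^ 2
  have hg : ∀ᶠ z in 𝓝[≠] 0, ContDiffAt ℝ 2 g z :=
    hf.mono fun z hz => hz.neg.add (contDiffAt_const.mul (hsq z))
  have hΔg : ∀ᶠ z in 𝓝[≠] 0, 0 < Δ g z := by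
    filter_upwards [hf, hΔ] with z hz hΔz
    rw [laplacian_add_const_mul hz.neg (hsq z), laplacian_norm_sq,
      show (fun w => -f w) = -f from rfl, InnerProductSpace.laplacian_neg]
    simp only [Pi.neg_apply, A]
    linarith [le_abs_self M, abs_nonneg M]
  obtain ⟨R, hR, m, hm⟩ := exists_forall_add_mul_log_norm_le hg hΔg
  have hbot {t : ℝ} (ht : 0 < t) : Tendsto (fun z => g z + t * Real.log ‖z‖) (𝓝[≠] 0) atBot := by
    refine tendsto_atBot_mono' _ ?_ (tendsto_atBot_add_const_left _ A
      (tendsto_log_norm_nhdsNE.const_mul_atBot (half_pos ht)))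
    filter_upwards [hlittle.bound (half_pos ht), eventually_norm_le_nhdsNE one_pos] with z hz hz1
    rw [Real.norm_eq_abs, Real.norm_eq_abs,
      abs_of_nonpos (Real.log_nonpos (norm_nonneg z) hz1.2)] at hz
    have hA : A * ‖z‖ ^ 2 ≤ A :=
      mul_le_of_le_one_right (by positivity) (pow_le_one₀ (norm_nonneg z) hz1.2)
    linarith [neg_le_abs (f z)]
  have hg_le : ∀ z, 0 < ‖z‖ → ‖z‖ ≤ R → g z ≤ m := by
    intro z hz hzR
    have hlim : Tendsto (fun t : ℝ => m + t * (Real.log R - Real.log ‖z‖)) (𝓝[>] 0) (𝓝 m) := by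
      refine tendsto_nhdsWithin_of_tendsto_nhds (Continuous.tendsto' (by fun_prop) _ _ (by simp))
    refine ge_of_tendsto hlim (eventually_mem_nhdsWithin.mono fun t ht => ?_)
    linarith [hm t (hbot ht) z hz hzR]
  refine ⟨-m, eventually_map.2 ?_⟩
  filter_upwards [eventually_norm_le_nhdsNE hR] with z hz
  have hA : 0 ≤ A * ‖z‖ ^ 2 := by positivity
  linarith [hg_le z hz.1 hz.2]

end PuncturedDisc

/-- `f` is a positive multiple of the gauge `ρ` to leading order along `l`: `f = ρ (C + o(1))` with
`C > 0`. The three kinds of singularities in the theorem are instances, with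
`ρ = r ^ (2 * α)`, `ρ = -(r ^ k * log r)` and `ρ = ((r * log r) ^ 2)⁻¹`. -/
def HasLeadingTerm {α : Type*} (l : Filter α) (f ρ : α → ℝ) : Prop :=
  ∃ C : ℝ, 0 < C ∧ Tendsto (fun x => f x / ρ x) l (𝓝 C)

namespace HasLeadingTerm

variable {α : Type*} {l : Filter α} {f ρ : α → ℝ}

theorem congr_right_iff {σ : α → ℝ} (hρ : ρ =ᶠ[l] σ) :
    HasLeadingTerm l f ρ ↔ HasLeadingTerm l f σ :=
  exists_congr fun _ => and_congr_right fun _ =>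
    tendsto_congr' (hρ.mono fun x hx => by simp only [hx])

theorem const_mul_sq {c : ℝ} (h : HasLeadingTerm l f ρ) (hc : 0 < c) :
    HasLeadingTerm l (fun x => c * f x ^ 2) (fun x => ρ x ^ 2) := by
  obtain ⟨C, hC, hlim⟩ := h
  refine ⟨c * C ^ 2, by positivity, ((hlim.pow 2).const_mul c).congr fun x => ?_⟩
  rw [div_pow, mul_div_assoc]

theorem eventually_ne_zero (h : HasLeadingTerm l f ρ) : ∀ᶠ x in l, f x ≠ 0 ∧ ρ x ≠ 0 := by
  obtain ⟨C, hC, hlim⟩ := h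
  exact (hlim.eventually_ne hC.ne').mono fun x hx => div_ne_zero_iff.1 hx

theorem exists_tendsto_log_sub_log (h : HasLeadingTerm l f ρ) :
    ∃ L, Tendsto (fun x => Real.log (f x) - Real.log (ρ x)) l (𝓝 L) := by
  have hne := h.eventually_ne_zero
  obtain ⟨C, hC, hlim⟩ := h
  exact ⟨Real.log C, (hlim.log hC.ne').congr' (hne.mono fun x hx => Real.log_div hx.1 hx.2)⟩

theorem exists_mul_le (h : HasLeadingTerm l f ρ) (hρ : ∀ᶠ x in l, 0 ≤ ρ x) :
    ∃ c > 0, ∀ᶠ x in l, c * ρ x ≤ f x := by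
  have hne := h.eventually_ne_zero
  obtain ⟨C, hC, hlim⟩ := h
  refine ⟨C / 2, half_pos hC, ?_⟩
  filter_upwards [hlim.eventually_const_le (half_lt_self hC), hρ, hne] with x hx hρx hnex
  rwa [le_div_iff₀ (hρx.lt_of_ne' hnex.2)] at hx

theorem exists_le_mul (h : HasLeadingTerm l f ρ) (hρ : ∀ᶠ x in l, 0 ≤ ρ x) :
    ∃ c > 0, ∀ᶠ x in l, f x ≤ c * ρ x := by
  have hne := h.eventually_ne_zero
  obtain ⟨C, hC, hlim⟩ := h
  refine ⟨2 * C, by positivity, ?_⟩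
  filter_upwards [hlim.eventually_le_const (by linarith : C < 2 * C), hρ, hne] with x hx hρx hnex
  rwa [div_le_iff₀ (hρx.lt_of_ne' hnex.2)] at hx

theorem iff_of_mul_sq_eq {D E F φ : α → ℝ} (hF : HasLeadingTerm l F φ)
    (hD : ∀ᶠ x in l, 0 < D x) (hρ : ∀ᶠ x in l, 0 < ρ x)
    (hDE : ∀ᶠ x in l, E x * D x ^ 2 = F x) :
    HasLeadingTerm l D ρ ↔ HasLeadingTerm l E (fun x => φ x / ρ x ^ 2) := by
  have hFφ := hF.eventually_ne_zero
  obtain ⟨K, hK, hF⟩ := hF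
  constructor
  · rintro ⟨C, hC, h⟩
    refine ⟨K / C ^ 2, by positivity, (hF.div (h.pow 2) (by positivity)).congr' ?_⟩
    filter_upwards [hDE, hD, hρ, hFφ] with x hx hDx hρx hFφx
    simp only [Pi.div_apply, ← hx]
    field_simp [hFφx.2]
  · rintro ⟨C, hC, h⟩
    refine ⟨√(K / C), by positivity, (hF.div h hC.ne').sqrt.congr' ?_⟩
    filter_upwards [hDE, hD, hρ, hFφ] with x hx hDx hρx hFφx
    have hE : E x ≠ 0 := left_ne_zero_of_mul (hx.trans_ne hFφx.1)
    rw [← Real.sqrt_sq (show 0 ≤ D x / ρ x by positivity), Pi.div_apply, ← hx]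
    congr 1
    field_simp [hFφx.2]

end HasLeadingTerm

theorem hasLeadingTerm_norm_of_meromorphicOrderAt_eq {𝕜 E : Type*} [NontriviallyNormedField 𝕜]
    [NormedAddCommGroup E] [NormedSpace 𝕜 E] {f : 𝕜 → E} {x : 𝕜} {n : ℤ}
    (hf : MeromorphicAt f x) (hn : meromorphicOrderAt f x = n) :
    HasLeadingTerm (𝓝[≠] x) (fun z => ‖f z‖) (fun z => ‖z - x‖ ^ n) := by
  obtain ⟨g, hg, hgx, hfg⟩ := (meromorphicOrderAt_eq_int_iff hf).1 hn
  refine ⟨‖g x‖, norm_pos_iff.2 hgx,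
    (hg.continuousAt.norm.tendsto.mono_left nhdsWithin_le_nhds).congr' ?_⟩
  filter_upwards [hfg, self_mem_nhdsWithin] with z hz hzx
  have hpow : ‖z - x‖ ^ n ≠ 0 := zpow_ne_zero _ (norm_ne_zero_iff.2 (sub_ne_zero.2 hzx))
  rw [hz, norm_smul, norm_zpow, mul_div_cancel_left₀ _ hpow]

theorem eventually_mem_puncturedDisc : ∀ᶠ z in 𝓝[≠] 0, z ∈ puncturedDisc := by
  filter_upwards [eventually_norm_le_nhdsNE one_half_pos] with z hz
  exact ⟨hz.1, by linarith [hz.2]⟩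

theorem hasCusp_iff {f : ℂ → ℝ} :
    HasCusp f ↔ HasLeadingTerm (𝓝[≠] 0) f (fun z => ((‖z‖ * Real.log ‖z‖) ^ 2)⁻¹) := by
  simp only [HasCusp, HasLeadingTerm, div_inv_eq_mul]

theorem eventually_rpow_norm_pos (β : ℝ) : ∀ᶠ z : ℂ in 𝓝[≠] 0, 0 < ‖z‖ ^ β :=
  eventually_mem_puncturedDisc.mono fun _ hz => Real.rpow_pos_of_pos hz.1 β

theorem eventually_neg_zpow_mul_log_norm_pos (k : ℤ) :
    ∀ᶠ z : ℂ in 𝓝[≠] 0, 0 < -(‖z‖ ^ k * Real.log ‖z‖) :=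
  eventually_mem_puncturedDisc.mono fun _ hz =>
    neg_pos.2 (mul_neg_of_pos_of_neg (zpow_pos hz.1 k) (Real.log_neg hz.1 hz.2))

theorem neg_log_le_inv {r : ℝ} (hr : 0 < r) : -Real.log r ≤ r⁻¹ := by
  rw [← Real.log_inv]
  exact Real.log_le_self (by positivity)

theorem isLittleO_one_log_norm :
    (fun _ : ℂ => (1 : ℝ)) =o[𝓝[≠] 0] fun z => Real.log ‖z‖ :=
  (Asymptotics.isLittleO_const_left_of_ne one_ne_zero).2
    (tendsto_abs_atBot_atTop.comp tendsto_log_norm_nhdsNE)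

theorem isLittleO_log_neg_log_norm :
    (fun z : ℂ => Real.log (-Real.log ‖z‖)) =o[𝓝[≠] 0] fun z => Real.log ‖z‖ := by
  have hneg := tendsto_neg_atBot_atTop.comp tendsto_log_norm_nhdsNE
  simpa [Function.comp_def] using Real.isLittleO_log_id_atTop.comp_tendsto hneg

namespace SpecialKahlerStructure

variable (S : SpecialKahlerStructure)

/-- The logarithm of `|z| ^ β / dens`: the Kähler potential of the hyperbolic metric that stays
bounded at a conical singularity `dens ~ |z| ^ β`. -/
noncomputable def logPotential (β : ℝ) (z : ℂ) : ℝ := -Real.log (S.dens z) + β * Real.log ‖z‖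

variable {S} {n : ℤ}

theorem contDiffAt_log_dens {z : ℂ} (hz : z ∈ puncturedDisc) :
    ContDiffAt ℝ 2 (fun w => Real.log (S.dens w)) z :=
  (((S.dens_smooth z hz).contDiffAt (isOpen_puncturedDisc.mem_nhds hz)).of_le
    (WithTop.coe_le_coe.2 le_top)).log (S.dens_pos z hz).ne'

theorem contDiffAt_logPotential (β : ℝ) {z : ℂ} (hz : z ∈ puncturedDisc) :
    ContDiffAt ℝ 2 (S.logPotential β) z :=
  (contDiffAt_log_dens hz).neg.add
    (contDiffAt_const.mul (contDiffAt_log_norm (norm_pos_iff.1 hz.1)))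

theorem laplacian_logPotential (β : ℝ) {z : ℂ} (hz : z ∈ S.nonzeroLocus) :
    Δ (S.logPotential β) z = S.hypDens z := by
  have hz0 : z ≠ 0 := norm_pos_iff.1 hz.1.1
  have hneg : Δ (fun w => -Real.log (S.dens w)) z = -Δ (fun w => Real.log (S.dens w)) z :=
    congrFun InnerProductSpace.laplacian_neg z
  unfold logPotential
  rw [laplacian_add_const_mul (contDiffAt_log_dens hz.1).neg (contDiffAt_log_norm hz0),
    laplacian_log_norm hz0, hneg, laplacian_log_dens_eq_neg_hypDens hz, neg_neg, mul_zero, add_zero]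

theorem exists_tendsto_logPotential_of_isConicalOfOrder {β : ℝ}
    (h : IsConicalOfOrder S.dens (β / 2)) : ∃ L, Tendsto (S.logPotential β) (𝓝[≠] 0) (𝓝 L) := by
  obtain ⟨L, hL⟩ := HasLeadingTerm.exists_tendsto_log_sub_log h
  refine ⟨-L, hL.neg.congr' ?_⟩
  filter_upwards [eventually_mem_puncturedDisc] with z hz
  rw [Real.log_rpow hz.1, logPotential]
  ring

theorem exists_tendsto_logPotential_add_of_hasLogSingularity {k : ℤ}
    (h : HasLogSingularity S.dens k) :
    ∃ L, Tendsto (fun z => S.logPotential k z + Real.log (-Real.log ‖z‖)) (𝓝[≠] 0) (𝓝 L) := by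
  obtain ⟨L, hL⟩ := HasLeadingTerm.exists_tendsto_log_sub_log h
  refine ⟨-L, hL.neg.congr' ?_⟩
  filter_upwards [eventually_mem_puncturedDisc] with z hz
  rw [← mul_neg, Real.log_mul (zpow_pos hz.1 k).ne' (neg_ne_zero.2 (Real.log_neg hz.1 hz.2).ne),
    Real.log_zpow, logPotential]
  ring

variable (hΞ : HasLeadingTerm (𝓝[≠] 0) (fun z => ‖S.cubicCoeff z‖) (fun z => ‖z‖ ^ n))
include hΞ

theorem eventually_mem_nonzeroLocus : ∀ᶠ z in 𝓝[≠] 0, z ∈ S.nonzeroLocus := by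
  filter_upwards [eventually_mem_puncturedDisc, hΞ.eventually_ne_zero] with z hz hne
  exact ⟨hz, norm_ne_zero_iff.1 hne.1⟩

theorem hasLeadingTerm_dens_iff {ρ : ℂ → ℝ} (hρ : ∀ᶠ z in 𝓝[≠] 0, 0 < ρ z) :
    HasLeadingTerm (𝓝[≠] 0) S.dens ρ ↔
      HasLeadingTerm (𝓝[≠] 0) S.hypDens (fun z => (‖z‖ ^ n / ρ z) ^ 2) := by
  simp only [div_pow]
  refine (hΞ.const_mul_sq (by norm_num : (0 : ℝ) < 16)).iff_of_mul_sq_eq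
    (eventually_mem_puncturedDisc.mono S.dens_pos) hρ ?_
  filter_upwards [eventually_mem_nonzeroLocus hΞ] with z hz
  rw [hypDens_eq hz, div_mul_cancel₀ _ (pow_ne_zero 2 (S.dens_pos z hz.1).ne')]

theorem not_isBoundedUnder_le_logPotential {σ : ℂ → ℝ} (β : ℝ)
    (h : HasLeadingTerm (𝓝[≠] 0) S.hypDens (fun z => σ z ^ 2))
    (hσ : ∀ᶠ z in 𝓝[≠] 0, ‖z‖⁻¹ ≤ σ z) :
    ¬ IsBoundedUnder (· ≤ ·) (𝓝[≠] 0) (S.logPotential β) := by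
  obtain ⟨c, hc, hle⟩ := h.exists_mul_le (.of_forall fun z => sq_nonneg (σ z))
  refine not_isBoundedUnder_le_of_div_norm_sq_le_laplacian hc
    (eventually_mem_puncturedDisc.mono fun z hz => contDiffAt_logPotential β hz) ?_
  filter_upwards [eventually_mem_nonzeroLocus hΞ, hle, hσ] with z hz hcz hσz
  calc c / ‖z‖ ^ 2 = c * ‖z‖⁻¹ ^ 2 := by rw [inv_pow, div_eq_mul_inv]
    _ ≤ c * σ z ^ 2 := by gcongr
    _ ≤ S.hypDens z := hcz
    _ = Δ (S.logPotential β) z := (laplacian_logPotential β hz).symm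

theorem isBoundedUnder_ge_logPotential {σ : ℂ → ℝ} {β : ℝ}
    (h : HasLeadingTerm (𝓝[≠] 0) S.hypDens (fun z => σ z ^ 2))
    (hσ : ∀ᶠ z in 𝓝[≠] 0, |σ z| ≤ 1)
    (hlittle : S.logPotential β =o[𝓝[≠] 0] fun z => Real.log ‖z‖) :
    IsBoundedUnder (· ≥ ·) (𝓝[≠] 0) (S.logPotential β) := by
  obtain ⟨c, hc, hle⟩ := h.exists_le_mul (.of_forall fun z => sq_nonneg (σ z))
  refine isBoundedUnder_ge_of_laplacian_le (M := c)
    (eventually_mem_puncturedDisc.mono fun z hz => contDiffAt_logPotential β hz) ?_ hlittle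
  filter_upwards [eventually_mem_nonzeroLocus hΞ, hle, hσ] with z hz hcz hσz
  rw [laplacian_logPotential β hz]
  exact hcz.trans (mul_le_of_le_one_right hc.le ((sq_le_one_iff_abs_le_one _).2 hσz))

theorem isConicalOfOrder_dens_iff (β : ℝ) :
    IsConicalOfOrder S.dens (β / 2) ↔ IsConicalOfOrder S.hypDens (n - β) := by
  refine (hasLeadingTerm_dens_iff hΞ (eventually_rpow_norm_pos (2 * (β / 2)))).trans
    (HasLeadingTerm.congr_right_iff ?_)
  filter_upwards [eventually_mem_puncturedDisc] with z hz
  rw [← Real.rpow_intCast, ← Real.rpow_sub hz.1, ← Real.rpow_natCast, ← Real.rpow_mul hz.1.le]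
  congr 1
  push_cast
  ring

theorem neg_one_lt_of_isConicalOfOrder_dens {β : ℝ} (h : IsConicalOfOrder S.dens (β / 2)) :
    -1 < n - β := by
  by_contra! hle
  have hhyp := (hasLeadingTerm_dens_iff hΞ (eventually_rpow_norm_pos (2 * (β / 2)))).1 h
  obtain ⟨L, hL⟩ := exists_tendsto_logPotential_of_isConicalOfOrder h
  refine not_isBoundedUnder_le_logPotential hΞ β hhyp ?_ hL.isBoundedUnder_le
  filter_upwards [eventually_mem_puncturedDisc] with z hz
  calc ‖z‖⁻¹ = ‖z‖ ^ (-1 : ℝ) := (Real.rpow_neg_one _).symm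
    _ ≤ ‖z‖ ^ (n - β) := Real.rpow_le_rpow_of_exponent_ge hz.1 hz.2.le hle
    _ = ‖z‖ ^ n / ‖z‖ ^ (2 * (β / 2)) := by
      rw [mul_div_cancel₀ β two_ne_zero, Real.rpow_sub hz.1, Real.rpow_intCast]

theorem hasLogSingularity_dens_iff_hasCusp_hypDens :
    HasLogSingularity S.dens (n + 1) ↔ HasCusp S.hypDens := by
  refine (hasLeadingTerm_dens_iff hΞ (eventually_neg_zpow_mul_log_norm_pos (n + 1))).trans
    ((HasLeadingTerm.congr_right_iff ?_).trans hasCusp_iff.symm)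
  filter_upwards [eventually_mem_puncturedDisc] with z hz
  have hlog : Real.log ‖z‖ ≠ 0 := (Real.log_neg hz.1 hz.2).ne
  have hpow : ‖z‖ ^ n ≠ 0 := (zpow_pos hz.1 n).ne'
  rw [zpow_add_one₀ hz.1.ne']
  field_simp

theorem le_of_hasLogSingularity_dens {k : ℤ} (h : HasLogSingularity S.dens k) : k ≤ n + 1 := by
  by_contra! hk
  have hhyp := (hasLeadingTerm_dens_iff hΞ (eventually_neg_zpow_mul_log_norm_pos k)).1 h
  obtain ⟨L, hL⟩ := exists_tendsto_logPotential_add_of_hasLogSingularity h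
  refine not_isBoundedUnder_le_logPotential hΞ k hhyp ?_ ?_
  · filter_upwards [eventually_mem_puncturedDisc, eventually_neg_zpow_mul_log_norm_pos k]
      with z hz hρ
    have hpow : ‖z‖ ^ k ≤ ‖z‖ ^ (n + 2) := zpow_le_zpow_right_of_le_one₀ hz.1 hz.2.le (by omega)
    rw [le_div_iff₀ hρ]
    calc ‖z‖⁻¹ * -(‖z‖ ^ k * Real.log ‖z‖) = ‖z‖⁻¹ * ‖z‖ ^ k * -Real.log ‖z‖ := by ring
      _ ≤ ‖z‖⁻¹ * ‖z‖ ^ (n + 2) * ‖z‖⁻¹ := by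
        gcongr
        · exact neg_nonneg.2 (Real.log_neg hz.1 hz.2).le
        · exact neg_log_le_inv hz.1
      _ = ‖z‖ ^ n := by
        rw [zpow_add₀ hz.1.ne']
        field_simp [hz.1.ne']
  · refine hL.isBoundedUnder_le.mono_le ?_
    filter_upwards [tendsto_log_norm_nhdsNE.eventually_le_atBot (-1)] with z hz
    exact le_add_of_nonneg_right (Real.log_nonneg (le_neg_of_le_neg hz))

theorem ge_of_hasLogSingularity_dens {k : ℤ} (h : HasLogSingularity S.dens k) : n + 1 ≤ k := by
  by_contra! hk
  have hhyp := (hasLeadingTerm_dens_iff hΞ (eventually_neg_zpow_mul_log_norm_pos k)).1 h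
  obtain ⟨L, hL⟩ := exists_tendsto_logPotential_add_of_hasLogSingularity h
  have hsplit : S.logPotential k =
      fun z => S.logPotential k z + Real.log (-Real.log ‖z‖) + -Real.log (-Real.log ‖z‖) := by
    simp only [add_neg_cancel_right]
  have hbot : Tendsto (S.logPotential k) (𝓝[≠] 0) atBot := by
    rw [hsplit]
    exact hL.add_atBot (tendsto_neg_atTop_atBot.comp
      (Real.tendsto_log_atTop.comp (tendsto_neg_atBot_atTop.comp tendsto_log_norm_nhdsNE)))
  refine not_isBoundedUnder_of_tendsto_atBot hbot (isBoundedUnder_ge_logPotential hΞ hhyp ?_ ?_)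
  · filter_upwards [eventually_mem_puncturedDisc, eventually_neg_zpow_mul_log_norm_pos k,
      tendsto_log_norm_nhdsNE.eventually_le_atBot (-1)] with z hz hρ hlog
    have hpow : ‖z‖ ^ n ≤ ‖z‖ ^ k := zpow_le_zpow_right_of_le_one₀ hz.1 hz.2.le (by omega)
    rw [abs_of_nonneg (div_nonneg (zpow_nonneg hz.1.le n) hρ.le), div_le_one hρ, ← mul_neg]
    exact hpow.trans (le_mul_of_one_le_right (zpow_nonneg hz.1.le k) (le_neg_of_le_neg hlog))
  · rw [hsplit]
    exact ((hL.isBigO_one ℝ).trans_isLittleO isLittleO_one_log_norm).add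
      isLittleO_log_neg_log_norm.neg_left

end SpecialKahlerStructure

theorem mainTheorem9 (S : SpecialKahlerStructure) (n : ℤ)
    (hmero : MeromorphicAt S.cubicCoeff 0)
    (hord : meromorphicOrderAt S.cubicCoeff 0 = (n : WithTop ℤ)) :
    (∀ β : ℝ,
      (IsConicalOfOrder S.dens (β / 2) ↔ IsConicalOfOrder S.hypDens ((n : ℝ) - β)) ∧
      (IsConicalOfOrder S.dens (β / 2) → -1 < (n : ℝ) - β)) ∧
    ((∃ k : ℤ, HasLogSingularity S.dens k) ↔ HasCusp S.hypDens) ∧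
    (HasLogSingularity S.dens (n + 1) ↔ HasCusp S.hypDens) := by
  have hΞ := hasLeadingTerm_norm_of_meromorphicOrderAt_eq hmero hord
  simp only [sub_zero] at hΞ
  have hcusp := SpecialKahlerStructure.hasLogSingularity_dens_iff_hasCusp_hypDens hΞ
  refine ⟨fun β => ⟨SpecialKahlerStructure.isConicalOfOrder_dens_iff hΞ β,
    SpecialKahlerStructure.neg_one_lt_of_isConicalOfOrder_dens hΞ⟩, ⟨?_, fun h => ?_⟩, hcusp⟩
  · rintro ⟨k, hk⟩
    have hkn : k = n + 1 := (SpecialKahlerStructure.le_of_hasLogSingularity_dens hΞ hk).antisymm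
      (SpecialKahlerStructure.ge_of_hasLogSingularity_dens hΞ hk)
    exact hcusp.1 (hkn ▸ hk)
  · exact ⟨n + 1, hcusp.2 h⟩
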